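/- Let $k$ be a field, and let $\mathcal C$ be the set of subrings of $k$ that are finitely generated as $\mathbb Z$-algebras, ordered by inclusion. A realization of a $k$-scheme $X$ is a family of finitely presented $A$-schemes $X_A$, indexed by all $A\in\mathcal C$ containing some fixed $A_0\in\mathcal C$, with isomorphisms $X_A\times_A k\simeq X$ and $X_A\times_A A'\simeq X_{A'}$ for all $A\subset A'$ in the index set. Realizations of group schemes, of group actions, of closed subgroups and of closed subschemes are defined in the same way: the members of the family are objects of the same kind over $A$, and the isomorphisms are compatible with the structure. Let $G$ be a $k$-group scheme acting on a proper $k$-scheme $X$, let $H_1,\dots,H_n$ be closed subgroup schemes of $G$, and let $Z$ be a closed subscheme of $X$. Let $(G_A)_A$, $(X_A)_A$, $(G_A\times_A X_A\to X_A)_A$, $(H_{iA}\hookrightarrow G_A)_A$ for $1\le i\le n$, and $(Z_A\hookrightarrow X_A)_A$ be families that together realize these data (so $G$, $X$, the $H_i$ and $Z$ are of finite type over $k$). Assume that for all large enough $A$ the schemes $Z_A$ and $H_{1A},\dots,H_{nA}$ have integral geometric fibers over $A$. Write $\left(\overline{H_1H_2\cdots H_n\cdot Z}\right)_{red}$ for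 the closure in $X$ of the image of the morphism $H_1\times_k\cdots\times_k H_n\times_k Z\to X$, $(h_1,\dots,h_n,z)\mapsto h_1h_2\cdots h_n\cdot z$, with its reduced scheme structure, and use the same notation over any other field. Then there exists a family of closed immersions $(Y_A\hookrightarrow X_A)_A$ that realizes the closed subscheme $\left(\overline{H_1H_2\cdots H_n\cdot Z}\right)_{red}\hookrightarrow X$, compatibly with the given realization $(X_A)_A$ of $X$, and such that for all large enough $A$: (i) $Y_A$ is proper and flat over $A$, with integral geometric fibers; (ii) for every geometric point $\bar s$ of $\mathrm{Spec}\,A$, $$(Y_A)_{\bar s}\simeq\left(\overline{H_{1A\bar s}H_{2A\bar s}\cdots H_{nA\bar s}\cdot Z_{A\bar s}}\right)_{red}$$ over $(X_A)_{\bar s}$. -/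

import Mathlib

open CategoryTheory AlgebraicGeometry MonoidalCategory MonObj
open scoped CategoryTheory.Obj

universe u

section Action

/-- A lax monoidal functor `F` transports an action of `M` on `X` to the action
`F M ⊗ F X ⟶ F (M ⊗ X) ⟶ F X` of `F M` on `F X`. -/
noncomputable abbrev modObjObj {C D : Type*} [Category C] [Category D] [MonoidalCategory C]
    [MonoidalCategory D] (F : C ⥤ D) [F.LaxMonoidal] (M X : C) [MonObj M] [ModObj M X] :
    ModObj (F.obj M) (F.obj X) where
  smul := Functor.LaxMonoidal.μ F M X ≫ F.map (γ[M, X] : M ⊗ X ⟶ X)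
  one_smul := by
    have h : (η[M] ▷ X) ≫ γ[M, X] = (λ_ X).hom := ModObj.one_smul (M := M) X
    change ((Functor.LaxMonoidal.ε F ≫ F.map η) ▷ F.obj X) ≫ _ ≫ F.map _ = (λ_ (F.obj X)).hom
    simp [← F.map_comp, h]
  mul_smul := by
    have h : (μ[M] ▷ X) ≫ γ[M, X] = (α_ M M X).hom ≫ (M ◁ γ[M, X]) ≫ γ[M, X] :=
      ModObj.mul_smul (M := M) X
    change ((Functor.LaxMonoidal.μ F M M ≫ F.map μ) ▷ F.obj X) ≫ _ ≫ F.map _ =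
      (α_ (F.obj M) (F.obj M) (F.obj X)).hom ≫
        (F.obj M ◁ (Functor.LaxMonoidal.μ F M X ≫ F.map γ[M, X])) ≫ _ ≫ F.map γ[M, X]
    simp_rw [comp_whiskerRight, Category.assoc, Functor.LaxMonoidal.μ_natural_left_assoc,
      MonoidalCategory.whiskerLeft_comp, Category.assoc,
      Functor.LaxMonoidal.μ_natural_right_assoc]
    slice_lhs 3 4 => rw [← F.map_comp, h]
    simp

/-- Base change of closed immersions. -/
lemma isClosedImmersion_pullback_map {S T : Scheme.{u}} (g : T ⟶ S) {X Y : Over S} (f : X ⟶ Y)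
    [IsClosedImmersion f.left] : IsClosedImmersion ((Over.pullback g).map f).left := by
  have h : IsPullback (Limits.pullback.fst X.hom g) ((Over.pullback g).map f).left f.left
      (Limits.pullback.fst Y.hom g) := by
    refine IsPullback.of_bot (v₂₁ := Limits.pullback.snd Y.hom g) (v₂₂ := Y.hom) (h₃₁ := g) ?_ ?_
      (IsPullback.of_hasPullback Y.hom g)
    · have e : ((Over.pullback g).map f).left ≫ Limits.pullback.snd Y.hom g =
          Limits.pullback.snd X.hom g := Limits.pullback.lift_snd _ _ _
      rw [e, Over.w]
      exact IsPullback.of_hasPullback X.hom g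
    · exact (Limits.pullback.lift_fst _ _ _).symm
  exact MorphismProperty.of_isPullback h ‹_›

end Action

/-! ### Group actions with closed subgroups and a closed subscheme -/

/-- A group scheme `G` over `S` acting on an `S`-scheme `X`, together with closed subgroup schemes
`H 0, …, H (n - 1)` of `G` and a closed subscheme `Z` of `X`. -/
structure ActionData (S : Scheme.{u}) (n : ℕ) where
  G : Over S
  [grpG : GrpObj G]
  X : Over S
  [action : ModObj G X]
  H : Fin n → Over S
  [grpH : ∀ i, GrpObj (H i)]
  incl : ∀ i, H i ⟶ G
  [incl_hom : ∀ i, IsMonHom (incl i)]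
  [incl_closed : ∀ i, IsClosedImmersion (incl i).left]
  Z : Over S
  emb : Z ⟶ X
  [emb_closed : IsClosedImmersion emb.left]

namespace ActionData

attribute [instance] grpG action grpH incl_hom incl_closed emb_closed

variable {S : Scheme.{u}} {n : ℕ}

/-- The action morphism `G ×_S X ⟶ X`. -/
def act (D : ActionData S n) : D.G ⊗ D.X ⟶ D.X := γ[D.G, D.X]

/-- The base change of all the data along `g : T ⟶ S`. -/
noncomputable def baseChange (D : ActionData S n) {T : Scheme.{u}} (g : T ⟶ S) :
    ActionData T n where
  G := (Over.pullback g).obj D.G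
  X := (Over.pullback g).obj D.X
  action := modObjObj (Over.pullback g) D.G D.X
  H i := (Over.pullback g).obj (D.H i)
  incl i := (Over.pullback g).map (D.incl i)
  incl_closed i := isClosedImmersion_pullback_map g (D.incl i)
  Z := (Over.pullback g).obj D.Z
  emb := (Over.pullback g).map D.emb
  emb_closed := isClosedImmersion_pullback_map g D.emb

/-- Isomorphisms between two such collections of data over the same base, compatible with the group
laws, the action, and the inclusions. -/
structure Iso (D E : ActionData S n) where
  G : D.G ≅ E.G
  [isMonHom_G : IsMonHom G.hom]
  X : D.X ≅ E.X
  act_comp : D.act ≫ X.hom = (G.hom ⊗ₘ X.hom) ≫ E.act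
  H : ∀ i, D.H i ≅ E.H i
  [isMonHom_H : ∀ i, IsMonHom (H i).hom]
  incl_comp : ∀ i, D.incl i ≫ G.hom = (H i).hom ≫ E.incl i
  Z : D.Z ≅ E.Z
  emb_comp : D.emb ≫ X.hom = Z.hom ≫ E.emb

/-- The morphism `H 0 × ⋯ × H (n - 1) × Z ⟶ X`, `(h₀, …, hₙ₋₁, z) ↦ h₀ · (h₁ · (⋯ (hₙ₋₁ · z)))`,
as an object over `X` (products are taken over `S`). -/
noncomputable def orbitMap (D : ActionData S n) : Over D.X :=
  Fin.foldr n (fun i T ↦ Over.mk ((D.incl i ⊗ₘ T.hom) ≫ D.act)) (Over.mk D.emb)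

/-- The subset `H 0 ⋯ H (n - 1) · Z` of `X`. -/
def orbitSet (D : ActionData S n) : Set D.X.left :=
  Set.range D.orbitMap.hom.left

/-- The ideal sheaf of all functions on `X` vanishing on the closure of `H 0 ⋯ H (n - 1) · Z`. -/
noncomputable def orbitIdeal (D : ActionData S n) : D.X.left.IdealSheafData :=
  .vanishingIdeal (.closure D.orbitSet)

/-- The closure of `H 0 ⋯ H (n - 1) · Z` with its reduced scheme structure. -/
noncomputable def orbitClosure (D : ActionData S n) : Over S :=
  Over.mk (D.orbitIdeal.subschemeι ≫ D.X.hom)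

/-- The closed immersion of the reduced closure of `H 0 ⋯ H (n - 1) · Z` into `X`. -/
noncomputable def orbitClosureι (D : ActionData S n) : D.orbitClosure ⟶ D.X :=
  Over.homMk D.orbitIdeal.subschemeι

end ActionData

/-! ### Realizations -/

/-- The subrings of `k` that are finitely generated `ℤ`-algebras, ordered by inclusion. -/
abbrev FGSubring (k : Type u) [Field k] : Type u := {A : Subalgebra ℤ k // A.FG}

namespace FGSubring

variable {k : Type u} [Field k]

/-- The affine scheme of a finitely generated subring. -/
noncomputable abbrev spec (A : FGSubring k) : Scheme.{u} := Spec (.of A.1)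

/-- The morphism `Spec k ⟶ Spec A` given by the inclusion `A ⊆ k`. -/
noncomputable def fromField (A : FGSubring k) : Spec (.of k) ⟶ A.spec :=
  Spec.map (CommRingCat.ofHom A.1.val.toRingHom)

/-- The morphism `Spec B ⟶ Spec A` given by an inclusion `A ⊆ B`. -/
noncomputable def transition {A B : FGSubring k} (h : A ≤ B) : B.spec ⟶ A.spec :=
  Spec.map (CommRingCat.ofHom (Subalgebra.inclusion h).toRingHom)

end FGSubring

/-- A morphism of schemes is of finite presentation if it is locally of finite presentation,
quasi-compact and quasi-separated. -/
def IsOfFinitePresentation {X Y : Scheme.{u}} (f : X ⟶ Y) : Prop :=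
  LocallyOfFinitePresentation f ∧ QuasiCompact f ∧ QuasiSeparated f

namespace ActionData

variable {k : Type u} [Field k] {n : ℕ}

/-- A realization of the data `D` over `k`: a family of data over all finitely generated subrings
`A` of `k` containing `base`, of finite presentation, whose base changes to larger finitely
generated subrings and to `k` are the other members of the family and `D`. -/
structure Realization (D : ActionData (Spec (.of k)) n) where
  base : FGSubring k
  obj : ∀ A : Set.Ici base, ActionData A.1.spec n
  finPres_G : ∀ A, IsOfFinitePresentation (obj A).G.hom
  finPres_X : ∀ A, IsOfFinitePresentation (obj A).X.hom
  finPres_H : ∀ A i, IsOfFinitePresentation ((obj A).H i).hom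
  finPres_Z : ∀ A, IsOfFinitePresentation (obj A).Z.hom
  isoField : ∀ A, ((obj A).baseChange A.1.fromField).Iso D
  iso : ∀ {A B : Set.Ici base} (h : A ≤ B),
    ((obj A).baseChange (FGSubring.transition h)).Iso (obj B)

/-- Let `(X_A)` be the realization of `X` that is part of the realization `R`. A family of closed
subschemes `Y_A` of the `X_A` realizes the closed subscheme `emb : Y ⟶ X` if the isomorphisms
between the base changes of the `X_A` restrict to isomorphisms of the closed subschemes. -/
structure Realization.ClosedSubscheme {D : ActionData (Spec (.of k)) n} (R : D.Realization)
    {Y : Over (Spec (.of k))} (emb : Y ⟶ D.X) where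
  base : FGSubring k
  le_base : R.base ≤ base
  obj : ∀ A : Set.Ici base, Over A.1.spec
  incl : ∀ A : Set.Ici base, obj A ⟶ (R.obj ⟨A, le_base.trans A.2⟩).X
  closed : ∀ A, IsClosedImmersion (incl A).left
  finPres : ∀ A, IsOfFinitePresentation (obj A).hom
  isoField : ∀ A, (Over.pullback A.1.fromField).obj (obj A) ≅ Y
  isoField_comp : ∀ A, (isoField A).hom ≫ emb =
    (Over.pullback A.1.fromField).map (incl A) ≫ (R.isoField ⟨A, le_base.trans A.2⟩).X.hom
  iso : ∀ {A B : Set.Ici base} (h : A ≤ B),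
    (Over.pullback (FGSubring.transition h)).obj (obj A) ≅ obj B
  iso_comp : ∀ {A B : Set.Ici base} (h : A ≤ B), (iso h).hom ≫ incl B =
    (Over.pullback (FGSubring.transition h)).map (incl A) ≫
      (R.iso (A := ⟨A, le_base.trans A.2⟩) (B := ⟨B, le_base.trans B.2⟩) h).X.hom

end ActionData

/-! Let `P = H₁ × ⋯ × Hₙ × Z` and let `f : P ⟶ X` be the orbit map over one large finitely generated
ring `A₀`. When `P` is reduced, the reduced closure of the image is cut out by the kernel of `f`,
i.e. it is the scheme-theoretic image (`vanishingIdeal_closure_range`). So it suffices that, after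
inverting one nonzero `a : A₀`, `P` stays integral over every noetherian domain `B` and
scheme-theoretic images commute with base change.

Integrality: `P` has geometrically integral fibres, because products of such schemes do, and it is
generically flat; over a noetherian domain this makes the total space integral.

Images: on affine pieces the map from `P` to its image is an injection `R → S` of finite type
algebras. It stays injective under every base change, flat or not, once the cokernel `S / R` is flat
over the base. This cokernel is in general neither an `S`-module nor a finite `R`-module, so generic
flatness is proved in the relative form `RelGenericallyFlat`, by adjoining one variable at a time
and filtering by its powers (`RelGenericallyFlat.of_filtration`). The result is
`exists_closure_range_comap`.

Since the same `a` serves all noetherian domains `B`, the property `OrbitClosureCommutes` can be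
applied to larger finitely generated rings, to `k`, and to arbitrary fields. This gives the
transition isomorphisms, the comparison with the closure over `k`, and the description and
integrality of the geometric fibres.

Properness of `X_A` for large `A` is `FGSubring.exists_isProper`. If the valuative criterion failed
over every `A`, the ultraproduct of the offending valuation rings would be a valuation ring over
`k`. The criterion for `X` holds there, and finite presentation returns it to some `A`. The closed
subscheme `Y_A` of `X_A` is then proper as well. -/

/-! ### Generic flatness, relative to a homomorphism of algebras -/

section GenericFlatness

open TensorProduct

/-- A module with an exhaustive increasing filtration by flat submodules is flat. -/
lemma Module.Flat.of_monotone_iSup {R M : Type*} [CommRing R] [AddCommGroup M] [Module R M]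
    (N : ℕ → Submodule R M) (hN : Monotone N) (h : ∀ j, Module.Flat R (N j))
    (hsup : ⨆ j, N j = ⊤) : Module.Flat R M := by
  rw [Module.Flat.iff_rTensor_injective']
  intro I
  have key (x : I ⊗[R] M) : ∃ j y, (N j).subtype.lTensor I y = x := by
    induction x with
    | zero => exact ⟨0, 0, map_zero _⟩
    | tmul p m =>
      have hm : m ∈ ⨆ j, N j := hsup ▸ Submodule.mem_top
      obtain ⟨j, hj⟩ := (Submodule.mem_iSup_of_directed _ hN.directed_le).mp hm
      exact ⟨j, p ⊗ₜ ⟨m, hj⟩, rfl⟩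
    | add x y hx hy =>
      obtain ⟨j, x, rfl⟩ := hx
      obtain ⟨k, y, rfl⟩ := hy
      have e (l) (h : l ≤ max j k) : (N l).subtype =
        (N (max j k)).subtype ∘ₗ Submodule.inclusion (hN h) := rfl
      exact ⟨max j k, (Submodule.inclusion (hN (le_max_left j k))).lTensor I x +
        (Submodule.inclusion (hN (le_max_right j k))).lTensor I y, by
        rw [map_add, e j (le_max_left _ _), e k (le_max_right _ _), LinearMap.lTensor_comp_apply,
          LinearMap.lTensor_comp_apply]⟩
  rw [injective_iff_map_eq_zero]
  intro x hx
  obtain ⟨j, y, rfl⟩ := key x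
  rw [← LinearMap.comp_apply, LinearMap.rTensor_comp_lTensor, ← LinearMap.lTensor_comp_rTensor,
    LinearMap.comp_apply] at hx
  have h1 : I.subtype.rTensor (N j) y = 0 := by
    apply Module.Flat.lTensor_preserves_injective_linearMap (M := R) _ (N j).injective_subtype
    rw [hx, map_zero]
  rw [(injective_iff_map_eq_zero _).mp
    (Module.Flat.rTensor_preserves_injective_linearMap (M := N j) _ I.injective_subtype) y h1,
    map_zero]

/-- An extension of flat modules is flat. -/
lemma Module.Flat.of_exact {R M M' M'' : Type*} [CommRing R] [AddCommGroup M] [Module R M]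
    [AddCommGroup M'] [Module R M'] [AddCommGroup M''] [Module R M'']
    (f : M' →ₗ[R] M) (g : M →ₗ[R] M'') (hf : Function.Injective f) (hg : Function.Surjective g)
    (H : Function.Exact f g) [Module.Flat R M'] [Module.Flat R M''] : Module.Flat R M := by
  rw [Module.Flat.iff_rTensor_preserves_injective_linearMap]
  intro P Q _ _ _ _ i hi
  rw [injective_iff_map_eq_zero]
  intro x hx
  have h1 : g.lTensor P x = 0 := by
    apply Module.Flat.rTensor_preserves_injective_linearMap (M := M'') i hi
    rw [map_zero, ← LinearMap.comp_apply, LinearMap.rTensor_comp_lTensor,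
      ← LinearMap.lTensor_comp_rTensor, LinearMap.comp_apply, hx, map_zero]
  obtain ⟨y, rfl⟩ := (_root_.lTensor_exact P H hg x).mp h1
  have h2 : i.rTensor M' y = 0 := by
    apply LinearMap.lTensor_injective_of_exact_of_flat g hg f hf H Q
    rw [map_zero, ← LinearMap.comp_apply, LinearMap.lTensor_comp_rTensor,
      ← LinearMap.rTensor_comp_lTensor, LinearMap.comp_apply, hx]
  rw [(injective_iff_map_eq_zero _).mp
    (Module.Flat.rTensor_preserves_injective_linearMap (M := M') i hi) y h2, map_zero]

/-- `FlatAway a M`: the localization of `M` away from `a` is flat, in a form stable under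
enlarging the localization. -/
def FlatAway {A : Type u} [CommRing A] (a : A) (M : Type u) [AddCommGroup M] [Module A M] : Prop :=
  ∀ (L : Type u) [CommRing L] [Algebra A L] [Module.Flat A L], IsUnit (algebraMap A L a) →
    Module.Flat A (L ⊗[A] M)

namespace FlatAway

variable {A : Type u} [CommRing A] {a b : A} {M N : Type u} [AddCommGroup M] [Module A M]
  [AddCommGroup N] [Module A N]

lemma of_dvd (h : FlatAway a M) (hab : a ∣ b) : FlatAway b M := fun L _ _ _ hb ↦
  h L (isUnit_of_dvd_unit (map_dvd _ hab) hb)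

lemma of_equiv (h : FlatAway a M) (e : M ≃ₗ[A] N) : FlatAway a N := fun L _ _ _ ha ↦
  have := h L ha
  Module.Flat.of_linearEquiv (e.symm.lTensor L)

lemma of_exact {M' M'' : Type u} [AddCommGroup M'] [Module A M'] [AddCommGroup M''] [Module A M'']
    (f : M' →ₗ[A] M) (g : M →ₗ[A] M'') (hf : Function.Injective f) (hg : Function.Surjective g)
    (H : Function.Exact f g) (h' : FlatAway a M') (h'' : FlatAway a M'') : FlatAway a M :=
  fun L _ _ _ ha ↦
    have := h' L ha
    have := h'' L ha
    Module.Flat.of_exact (f.lTensor L) (g.lTensor L)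
      (Module.Flat.lTensor_preserves_injective_linearMap f hf) (LinearMap.lTensor_surjective L hg)
      (lTensor_exact L H hg)

lemma of_monotone_iSup (N : ℕ → Submodule A M) (hN : Monotone N) (h : ∀ j, FlatAway a (N j))
    (hsup : ⨆ j, N j = ⊤) : FlatAway a M := by
  intro L _ _ _ ha
  refine Module.Flat.of_monotone_iSup (fun j ↦ LinearMap.range ((N j).subtype.lTensor L))
    ?_ (fun j ↦ ?_) ?_
  · intro i j hij
    have : (N i).subtype = (N j).subtype ∘ₗ Submodule.inclusion (hN hij) := rfl
    dsimp only
    rw [this, LinearMap.lTensor_comp]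
    exact LinearMap.range_comp_le_range _ _
  · have := h j L ha
    exact Module.Flat.of_linearEquiv (LinearEquiv.ofInjective _
      (Module.Flat.lTensor_preserves_injective_linearMap (M := L) (N j).subtype
        (N j).injective_subtype)).symm
  · rw [eq_top_iff]
    rintro x -
    induction x with
    | zero => exact zero_mem _
    | add x y hx hy => exact add_mem hx hy
    | tmul l m =>
      have hm : m ∈ ⨆ j, N j := hsup ▸ Submodule.mem_top
      obtain ⟨j, hj⟩ := (Submodule.mem_iSup_of_directed _ hN.directed_le).mp hm
      exact Submodule.mem_iSup_of_mem j ⟨l ⊗ₜ ⟨m, hj⟩, rfl⟩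

end FlatAway

/-- `M` becomes flat after inverting a nonzero element. -/
def GenericallyFlat (A : Type u) [CommRing A] (M : Type u) [AddCommGroup M] [Module A M] : Prop :=
  ∃ a : A, a ≠ 0 ∧ FlatAway a M

/-- The generic fibre is a vector space, hence free, and freeness of a finitely presented module
spreads out after inverting one element. -/
lemma GenericallyFlat.of_finite (A : Type u) [CommRing A] [IsDomain A] [IsNoetherianRing A]
    (M : Type u) [AddCommGroup M] [Module A M] [Module.Finite A M] : GenericallyFlat A M := by
  have : Module.FinitePresentation A M := Module.finitePresentation_of_finite A M
  obtain ⟨a, ha, hfree, -⟩ := Module.FinitePresentation.exists_free_localizedModule_powers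
    (nonZeroDivisors A) (LocalizedModule.mkLinearMap (nonZeroDivisors A) M) (FractionRing A)
  refine ⟨a, nonZeroDivisors.ne_zero ha, fun L _ _ _ hL ↦ ?_⟩
  let := (IsLocalization.Away.lift (S := Localization.Away a) a hL).toAlgebra
  have : IsScalarTower A (Localization.Away a) L := .of_algebraMap_eq fun x ↦
    (IsLocalization.Away.lift_eq a hL x).symm
  have : Module.Free (Localization.Away a) (LocalizedModule.Away a M) := hfree
  have e : LocalizedModule.Away a M ≃ₗ[Localization.Away a] Localization.Away a ⊗[A] M :=
    LocalizedModule.equivTensorProduct (.powers a) M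
  have : Module.Free (Localization.Away a) (Localization.Away a ⊗[A] M) := .of_equiv e
  have : Module.Free L (L ⊗[A] M) := .of_equiv
    (AlgebraTensorModule.cancelBaseChange A (Localization.Away a) L L M)
  exact Module.Flat.trans A L _

lemma GenericallyFlat.of_equiv {A : Type u} [CommRing A] {M N : Type u} [AddCommGroup M]
    [Module A M] [AddCommGroup N] [Module A N] (h : GenericallyFlat A M) (e : M ≃ₗ[A] N) :
    GenericallyFlat A N := by
  obtain ⟨a, ha, h⟩ := h
  exact ⟨a, ha, h.of_equiv e⟩

/-- Every quotient of a finite `T`-module by a finitely generated `R`-submodule is generically flat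
over `A`. -/
def RelGenericallyFlat (A R T : Type u) [CommRing A] [CommRing R] [CommRing T] [Algebra A R]
    [Algebra R T] [Algebra A T] : Prop :=
  ∀ (M : Type u) [AddCommGroup M] [Module T M] [Module R M] [Module A M] [IsScalarTower R T M]
    [IsScalarTower A R M] [IsScalarTower A T M],
    Module.Finite T M → ∀ N : Submodule R M, N.FG → GenericallyFlat A (M ⧸ N)

section Filtration

variable {T M : Type u} [CommRing T] [AddCommGroup M] [Module T M]

/-- The submodule `M₀ + x M₀ + ⋯ + x ^ j M₀`. -/
def powFiltration (x : M →ₗ[T] M) (M₀ : Submodule T M) : ℕ → Submodule T M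
  | 0 => M₀
  | j + 1 => M₀ ⊔ (powFiltration x M₀ j).map x

variable (x : M →ₗ[T] M) (M₀ : Submodule T M)

lemma le_powFiltration (j : ℕ) : M₀ ≤ powFiltration x M₀ j := by
  cases j with
  | zero => exact le_rfl
  | succ j => exact le_sup_left

lemma powFiltration_monotone : Monotone (powFiltration x M₀) := by
  refine monotone_nat_of_le_succ fun j ↦ ?_
  induction j with
  | zero => exact le_sup_left
  | succ j ih => exact sup_le_sup_left (Submodule.map_mono ih) _

lemma powFiltration_succ (j : ℕ) :
    powFiltration x M₀ (j + 1) = powFiltration x M₀ j ⊔ M₀.map (x ^ (j + 1)) := by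
  induction j with
  | zero => simp [powFiltration]
  | succ j ih =>
    rw [powFiltration, ih, Submodule.map_sup, ← sup_assoc, ← powFiltration, ← ih,
      ← Submodule.map_comp, pow_succ' x (j + 1)]
    rfl

/-- The kernel of `x ^ (j + 1)` as a map from `M₀` to the graded piece of the filtration. -/
def powFiltrationKer (j : ℕ) : Submodule T M₀ :=
  ((powFiltration x M₀ j).comap (x ^ (j + 1))).comap M₀.subtype

/-- If `x ^ (j + 1)` sends `m` into step `j`, one more application of `x` lands in step `j + 1`.
Monotonicity lets noetherianity leave only finitely many distinct graded pieces. -/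
lemma powFiltrationKer_monotone : Monotone (powFiltrationKer x M₀) := by
  refine monotone_nat_of_le_succ fun j m hm ↦ ?_
  have e : (x ^ (j + 1 + 1)) (m : M) = x ((x ^ (j + 1)) m) := by rw [pow_succ' x (j + 1)]; rfl
  change (x ^ (j + 1 + 1)) (m : M) ∈ powFiltration x M₀ (j + 1)
  rw [e]
  exact Submodule.mem_sup_right ⟨_, hm, rfl⟩

lemma iSup_powFiltration_eq_top (h : ∀ P : Submodule T M, M₀ ≤ P → P.map x ≤ P → P = ⊤) :
    ⨆ j, powFiltration x M₀ j = ⊤ := by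
  refine h _ (le_iSup (powFiltration x M₀) 0) ?_
  rw [Submodule.map_iSup, iSup_le_iff]
  exact fun j ↦ le_trans le_sup_right (le_iSup (powFiltration x M₀) (j + 1))

end Filtration

/-- Dévissage: filter `M ⧸ N` by the images of `M₀ + x M₀ + ⋯ + x ^ j M₀`. The bottom step is `M₀`
modulo `N`, and each graded piece is a quotient `M₀ ⧸ K j` of a finite `T`-module, so `H` applies to
all of them. The `K j` stabilize, so one nonzero element makes every piece flat; extensions and
increasing unions then preserve flatness. -/
lemma RelGenericallyFlat.of_filtration {A R T : Type u} [CommRing A] [IsDomain A] [CommRing R]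
    [CommRing T] [IsNoetherianRing T] [Algebra A R] [Algebra R T] [Algebra A T]
    (H : RelGenericallyFlat A R T)
    {M : Type u} [AddCommGroup M] [Module T M] [Module R M] [Module A M] [IsScalarTower R T M]
    [IsScalarTower A R M] [IsScalarTower A T M] (x : M →ₗ[T] M) (M₀ : Submodule T M)
    (hM₀ : M₀.FG) (hx : ∀ P : Submodule T M, M₀ ≤ P → P.map x ≤ P → P = ⊤)
    (N : Submodule R M) (hN : N.FG) (hNM : (N : Set M) ⊆ M₀) : GenericallyFlat A (M ⧸ N) := by
  have : Module.Finite T M₀ := .of_fg hM₀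
  let K := powFiltrationKer x M₀
  obtain ⟨n, hn⟩ := monotone_stabilizes_iff_noetherian.mpr
    (inferInstance : IsNoetherian T M₀) ⟨K, powFiltrationKer_monotone x M₀⟩
  have hK (j) : GenericallyFlat A (M₀ ⧸ K j) :=
    (H (M₀ ⧸ K j) inferInstance ⊥ Submodule.fg_bot).of_equiv
      ((Submodule.quotEquivOfEqBot ⊥ rfl).restrictScalars A)
  let i₀ : M₀ →ₗ[R] M := M₀.subtype.restrictScalars R
  have hN₀ : GenericallyFlat A (M₀ ⧸ N.comap i₀) := by
    refine H M₀ ‹_› _ (Submodule.fg_of_fg_map_injective i₀ Subtype.val_injective ?_)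
    rwa [Submodule.map_comap_eq_of_le]
    exact fun m hm ↦ ⟨⟨m, hNM hm⟩, rfl⟩
  choose a ha0 ha using hK
  obtain ⟨b, hb0, hb⟩ := hN₀
  -- `K j = K n` for `j ≥ n`, so the indices up to and including `n` account for all graded pieces.
  let c := b * ∏ j ∈ Finset.range (n + 1), a j
  have hc (j) : FlatAway c (M₀ ⧸ K j) := by
    obtain ⟨l, hl, e⟩ : ∃ l ≤ n, K j = K l := by
      rcases le_total j n with h | h
      · exact ⟨j, h, rfl⟩
      · exact ⟨n, le_rfl, (hn j h).symm⟩
    rw [e]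
    exact (ha l).of_dvd (dvd_mul_of_dvd_right (Finset.dvd_prod_of_mem a
      (Finset.mem_range.mpr (Nat.lt_succ_of_le hl))) b)
  refine ⟨c, mul_ne_zero hb0 (Finset.prod_ne_zero_iff.mpr fun j _ ↦ ha0 j), ?_⟩
  let q : M →ₗ[A] M ⧸ N := N.mkQ.restrictScalars A
  have hq (m : M) : q m = 0 ↔ m ∈ N := Submodule.Quotient.mk_eq_zero N
  let Q (j : ℕ) : Submodule A (M ⧸ N) := ((powFiltration x M₀ j).restrictScalars A).map q
  have hQ : Monotone Q := fun i j hij ↦ Submodule.map_mono (powFiltration_monotone x M₀ hij)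
  -- Since `N ⊆ M₀` lies in every step, passing to the quotient by `N` does not change the graded
  -- pieces.
  have hmem (m : M) (j) : q m ∈ Q j ↔ m ∈ powFiltration x M₀ j := by
    refine ⟨?_, fun h ↦ ⟨m, h, rfl⟩⟩
    rintro ⟨m', hm', e⟩
    rw [← sub_eq_zero, ← map_sub, hq] at e
    have := le_powFiltration x M₀ j (hNM e)
    simpa using sub_mem hm' this
  refine FlatAway.of_monotone_iSup Q hQ (fun j ↦ ?_) ?_
  · induction j with
    | zero =>
      let r : M₀ →ₗ[A] Q 0 := (q ∘ₗ M₀.subtype.restrictScalars A).codRestrict (Q 0)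
        fun m ↦ ⟨m, m.2, rfl⟩
      have hr : Function.Surjective r := by
        rintro ⟨_, m, hm, rfl⟩
        exact ⟨⟨m, hm⟩, rfl⟩
      have e : LinearMap.ker r = (N.comap i₀).restrictScalars A := by
        ext m
        rw [LinearMap.mem_ker, ← Submodule.coe_eq_zero]
        exact hq m
      have h1 := (hb.of_dvd (dvd_mul_right b _ : b ∣ c))
      exact h1.of_equiv ((Submodule.Quotient.restrictScalarsEquiv A (N.comap i₀)).symm ≪≫ₗ
        Submodule.quotEquivOfEq _ _ e.symm ≪≫ₗ r.quotKerEquivOfSurjective hr)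
    | succ j ih =>
      let Q' := (Q j).submoduleOf (Q (j + 1))
      let y : M₀ →ₗ[A] M := ((x ^ (j + 1)) ∘ₗ M₀.subtype).restrictScalars A
      have hy (m) : y m ∈ powFiltration x M₀ (j + 1) := by
        rw [powFiltration_succ]
        exact Submodule.mem_sup_right ⟨m, m.2, rfl⟩
      let r : M₀ →ₗ[A] Q (j + 1) := (q ∘ₗ y).codRestrict _ fun m ↦ ⟨_, hy m, rfl⟩
      have hr : Function.Surjective (Q'.mkQ ∘ₗ r) := by
        intro z
        obtain ⟨⟨_, m, hm, rfl⟩, rfl⟩ := Q'.mkQ_surjective z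
        have hm' : m ∈ powFiltration x M₀ (j + 1) := hm
        rw [powFiltration_succ] at hm'
        obtain ⟨m₁, h₁, _, ⟨m₂, h₂, rfl⟩, rfl⟩ := Submodule.mem_sup.mp hm'
        refine ⟨⟨m₂, h₂⟩, (Submodule.Quotient.eq Q').mpr ?_⟩
        change q _ - q _ ∈ Q j
        rw [← map_sub, hmem]
        have e : y ⟨m₂, h₂⟩ - (m₁ + (x ^ (j + 1)) m₂) = -m₁ := by
          change (x ^ (j + 1)) m₂ - _ = _
          abel
        exact e ▸ neg_mem h₁
      have e : LinearMap.ker (Q'.mkQ ∘ₗ r) = (K j).restrictScalars A := by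
        ext m
        rw [LinearMap.mem_ker]
        exact (Submodule.Quotient.mk_eq_zero Q').trans (hmem (y m) j)
      have h2 : FlatAway c (Q (j + 1) ⧸ Q') := (hc j).of_equiv
        ((Submodule.Quotient.restrictScalarsEquiv A (K j)).symm ≪≫ₗ
          Submodule.quotEquivOfEq _ _ e.symm ≪≫ₗ LinearMap.quotKerEquivOfSurjective _ hr)
      exact FlatAway.of_exact (Submodule.inclusion (hQ j.le_succ)) Q'.mkQ
        (Submodule.inclusion_injective _) Q'.mkQ_surjective
        (LinearMap.exact_iff.mpr (by rw [Submodule.ker_mkQ, Submodule.range_inclusion]; rfl))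
        ih h2
  · rw [eq_top_iff]
    rintro z -
    obtain ⟨m, rfl⟩ := N.mkQ_surjective z
    have hm : m ∈ ⨆ j, powFiltration x M₀ j := iSup_powFiltration_eq_top x M₀ hx ▸ Submodule.mem_top
    obtain ⟨j, hj⟩ := (Submodule.mem_iSup_of_directed _
      (powFiltration_monotone x M₀).directed_le).mp hm
    exact Submodule.mem_iSup_of_mem j ⟨m, hj, rfl⟩

/-- `RelGenericallyFlat` carries separate module structures over `A`, `R` and `T`; when two of these
rings are equal, the structures agree only propositionally. -/
lemma Module.eq_of_isScalarTower {R M : Type*} [CommRing R] [AddCommGroup M] (i j : Module R M)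
    (h : @IsScalarTower R R M _ i.toSMul j.toSMul) : i = j :=
  Module.ext' _ _ fun r m ↦ by
    have e := @IsScalarTower.smul_assoc R R M _ i.toSMul j.toSMul h r 1 m
    rwa [smul_eq_mul, _root_.mul_one, @one_smul _ _ _ i.toMulAction] at e

namespace RelGenericallyFlat

variable {A R T T' : Type u} [CommRing A] [CommRing R] [CommRing T] [CommRing T'] [Algebra A R]
  [Algebra R T] [Algebra A T] [Algebra R T'] [Algebra A T'] [IsScalarTower A R T]
  [IsScalarTower A R T']

lemma of_surjective (H : RelGenericallyFlat A R T) (f : T →ₐ[R] T') (hf : Function.Surjective f) :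
    RelGenericallyFlat A R T' := by
  intro M _ _ _ _ _ _ _ hM N hN
  let := Module.compHom M (f : T →+* T')
  have hsmul (t : T) (m : M) : t • m = f t • m := rfl
  have : IsScalarTower R T M := ⟨fun r t m ↦ by simp [hsmul]⟩
  have : IsScalarTower A T M := ⟨fun r t m ↦ by
    rw [hsmul, hsmul, ← IsScalarTower.algebraMap_smul R r t, map_smul,
      IsScalarTower.algebraMap_smul, smul_assoc]⟩
  refine H M ?_ N hN
  obtain ⟨s, hs⟩ := hM.fg_top
  refine ⟨⟨s, ?_⟩⟩
  rw [eq_top_iff]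
  rintro m -
  have hm : m ∈ Submodule.span T' (s : Set M) := hs ▸ Submodule.mem_top
  induction hm using Submodule.span_induction with
  | mem x h => exact Submodule.subset_span h
  | zero => exact zero_mem _
  | add x y _ _ hx hy => exact add_mem hx hy
  | smul a x _ hx =>
    obtain ⟨t, rfl⟩ := hf a
    exact Submodule.smul_mem _ t hx

omit [IsScalarTower A R T] in
-- The operator of the filtration is multiplication by the variable.
lemma polynomial [IsDomain A] [IsNoetherianRing T] (H : RelGenericallyFlat A R T) :
    RelGenericallyFlat A R (Polynomial T) := by
  intro M _ _ _ _ _ _ _ hM N hN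
  let := Module.compHom M (Polynomial.C : T →+* Polynomial T)
  have hsmul (t : T) (m : M) : t • m = (Polynomial.C t : Polynomial T) • m := rfl
  have : IsScalarTower R T M := ⟨fun r t m ↦ by
    rw [hsmul, hsmul, ← smul_assoc, Polynomial.smul_C]⟩
  have : IsScalarTower A T M := ⟨fun r t m ↦ by
    rw [hsmul, hsmul, ← smul_assoc, Polynomial.smul_C]⟩
  have : IsScalarTower T (Polynomial T) M := ⟨fun r t m ↦ by
    rw [hsmul, ← smul_assoc, smul_eq_mul, Polynomial.smul_eq_C_mul]⟩
  let x : M →ₗ[T] M := (LinearMap.lsmul (Polynomial T) M Polynomial.X).restrictScalars T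
  obtain ⟨s, hs⟩ := hM.fg_top
  obtain ⟨t, ht⟩ := hN
  classical
  -- Generators of `N` are added to those of `M` so that `N` lies in the bottom step of the
  -- filtration.
  refine H.of_filtration x (Submodule.span T (s ∪ t : Finset M)) ⟨_, rfl⟩ ?_ N ⟨t, ht⟩ ?_
  · intro P hP hxP
    let P' : Submodule (Polynomial T) M :=
      { P with
        smul_mem' := fun p m hm ↦ by
          change p • m ∈ P
          induction p using Polynomial.induction_on' with
          | add p q hp hq => rw [add_smul]; exact add_mem hp hq
          | monomial n a =>
            rw [← Polynomial.C_mul_X_pow_eq_monomial, mul_smul]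
            refine P.smul_mem a ?_
            induction n with
            | zero => simpa
            | succ n ih => rw [pow_succ', mul_smul]; exact hxP ⟨_, ih, rfl⟩ }
    have hP' : P' = ⊤ := by
      rw [eq_top_iff, ← hs, Submodule.span_le]
      exact fun m hm ↦ hP (Submodule.subset_span (by simp [Finset.mem_coe.mp hm]))
    rw [eq_top_iff]
    intro m hm
    change m ∈ P'
    rw [hP']; trivial
  · rw [← ht]
    intro m hm
    induction hm using Submodule.span_induction with
    | mem x h => exact Submodule.subset_span (by simp [Finset.mem_coe.mp h])
    | zero => exact zero_mem _
    | add x y _ _ hx hy => exact add_mem hx hy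
    | smul a x _ hx =>
      rw [← IsScalarTower.algebraMap_smul T a x]
      exact Submodule.smul_mem _ _ hx

lemma mvPolynomial [IsDomain A] [IsNoetherianRing R] (H : RelGenericallyFlat A R R) (n : ℕ) :
    RelGenericallyFlat A R (MvPolynomial (Fin n) R) := by
  induction n with
  | zero =>
    exact H.of_surjective (MvPolynomial.isEmptyAlgEquiv R (Fin 0)).symm.toAlgHom
      (MvPolynomial.isEmptyAlgEquiv R (Fin 0)).symm.surjective
  | succ n ih =>
    exact ih.polynomial.of_surjective (MvPolynomial.finSuccEquiv R n).symm.toAlgHom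
      (MvPolynomial.finSuccEquiv R n).symm.surjective

lemma of_finiteType [IsDomain A] [IsNoetherianRing R] (H : RelGenericallyFlat A R R)
    [Algebra.FiniteType R T] : RelGenericallyFlat A R T := by
  obtain ⟨n, f, hf⟩ := Algebra.FiniteType.iff_quotient_mvPolynomial''.mp
    (inferInstance : Algebra.FiniteType R T)
  exact (H.mvPolynomial n).of_surjective f hf

variable (A)

lemma self [IsDomain A] [IsNoetherianRing A] : RelGenericallyFlat A A A := by
  intro M _ i₁ i₂ i₃ _ _ _ hM N hN
  obtain rfl : i₁ = i₂ := Module.eq_of_isScalarTower i₁ i₂ ‹_›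
  obtain rfl : i₁ = i₃ := Module.eq_of_isScalarTower i₁ i₃ ‹_›
  exact .of_finite A _

/-- The induction runs twice: from `A` to `R`, giving generic flatness of all finite `R`-modules,
and then with this statement as its base case from `R` to an `R`-algebra. -/
lemma self_of_finiteType [IsDomain A] [IsNoetherianRing A] [Algebra.FiniteType A R] :
    RelGenericallyFlat A R R := by
  intro M _ i₁ i₂ _ _ _ _ hM N hN
  obtain rfl : i₁ = i₂ := Module.eq_of_isScalarTower i₁ i₂ ‹_›
  exact (of_finiteType (T := R) (self A) (M ⧸ N) inferInstance ⊥ Submodule.fg_bot).of_equiv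
      (Submodule.quotEquivOfEqBot ⊥ rfl)

end RelGenericallyFlat

/-- **Generic flatness** of the cokernel of a homomorphism of finite type algebras. -/
lemma genericallyFlat_quotient_range (A : Type u) {R S : Type u} [CommRing A] [IsDomain A]
    [IsNoetherianRing A] [CommRing R] [CommRing S] [Algebra A R] [Algebra.FiniteType A R]
    [Algebra R S] [Algebra A S] [IsScalarTower A R S] [Algebra.FiniteType R S] :
    GenericallyFlat A (S ⧸ LinearMap.range (Algebra.linearMap R S)) :=
  have : IsNoetherianRing R := Algebra.FiniteType.isNoetherianRing A R
  RelGenericallyFlat.of_finiteType (T := S) (RelGenericallyFlat.self_of_finiteType A) S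
    inferInstance _ (by rw [LinearMap.range_eq_map]; exact Module.Finite.fg_top.map _)

/-- **Generic flatness** of finite type algebras. -/
lemma genericallyFlat_of_finiteType (A : Type u) {R : Type u} [CommRing A] [IsDomain A]
    [IsNoetherianRing A] [CommRing R] [Algebra A R] [Algebra.FiniteType A R] :
    GenericallyFlat A R :=
  (RelGenericallyFlat.self_of_finiteType (R := R) A R inferInstance ⊥ Submodule.fg_bot).of_equiv
    ((Submodule.quotEquivOfEqBot ⊥ rfl).restrictScalars A)

/-- An injective homomorphism with flat cokernel away from `a` remains injective after tensoring
with an algebra in which `a` is a unit. -/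
lemma FlatAway.lTensor_injective {A : Type u} [CommRing A] {a : A} {M N P : Type u} [AddCommGroup M]
    [Module A M] [AddCommGroup N] [Module A N] [AddCommGroup P] [Module A P]
    (f : M →ₗ[A] N) (g : N →ₗ[A] P) (hf : Function.Injective f) (hg : Function.Surjective g)
    (H : Function.Exact f g) (h : FlatAway a P) (B : Type u) [CommRing B] [Algebra A B]
    (ha : IsUnit (algebraMap A B a)) : Function.Injective (f.lTensor B) := by
  let L := Localization.Away a
  have : Module.Flat A L := IsLocalization.flat L (.powers a)
  have := h L (IsLocalization.Away.algebraMap_isUnit a)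
  have h1 : Function.Injective ((f.lTensor L).lTensor B) :=
    LinearMap.lTensor_injective_of_exact_of_flat (g.lTensor L) (LinearMap.lTensor_surjective L hg) _
      (Module.Flat.lTensor_preserves_injective_linearMap f hf) (lTensor_exact L H hg) B
  let := (IsLocalization.Away.lift (S := L) a ha).toAlgebra
  have : IsScalarTower A L B := .of_algebraMap_eq fun x ↦ (IsLocalization.Away.lift_eq a ha x).symm
  let r (Q : Type u) [AddCommGroup Q] [Module A Q] : B ⊗[A] (L ⊗[A] Q) →ₗ[A] B ⊗[A] Q :=
    ((Algebra.TensorProduct.lift (.id A B) (IsScalarTower.toAlgHom A L B)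
      fun _ _ ↦ .all _ _).toLinearMap.rTensor Q) ∘ₗ (TensorProduct.assoc A B L Q).symm.toLinearMap
  -- `i` is natural and has the left inverse `r`, so injectivity after tensoring with `L` and then
  -- `B` descends to `B` alone.
  let i (Q : Type u) [AddCommGroup Q] [Module A Q] : B ⊗[A] Q →ₗ[A] B ⊗[A] (L ⊗[A] Q) :=
    LinearMap.lTensor B (TensorProduct.mk A L Q 1)
  have hri (Q : Type u) [AddCommGroup Q] [Module A Q] (x : B ⊗[A] Q) : r Q (i Q x) = x := by
    induction x with
    | zero => simp
    | add x y hx hy => rw [map_add, map_add, hx, hy]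
    | tmul b q => simp [r, i]
  have hi (x : B ⊗[A] M) : (f.lTensor L).lTensor B (i M x) = i N (f.lTensor B x) := by
    induction x with
    | zero => simp
    | add x y hx hy => simp only [map_add, hx, hy]
    | tmul b q => simp [i]
  intro x y hxy
  rw [← hri M x, ← hri M y]
  exact congr_arg _ (h1 (by rw [hi, hi, hxy]))

end GenericFlatness

/-! ### Scheme-theoretic dominance under base change -/

section GenericDominance

open TensorProduct

/-- `FlatAway` speaks only of flat algebras, but an arbitrary `B` in which `a` is a unit receives a
map from `Localization.Away a`, and flatness survives base change from there. -/
lemma FlatAway.flat_tensorProduct {A : Type u} [CommRing A] {a : A} {M : Type u} [AddCommGroup M]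
    [Module A M] (h : FlatAway a M) (B : Type u) [CommRing B] [Algebra A B]
    (ha : IsUnit (algebraMap A B a)) : Module.Flat B (B ⊗[A] M) := by
  let L := Localization.Away a
  have : Module.Flat A L := IsLocalization.flat L (.powers a)
  have := h L (IsLocalization.Away.algebraMap_isUnit a)
  have : Module.Flat L (L ⊗[A] M) :=
    (Module.flat_iff_of_isLocalization L (.powers a) _).mpr this
  let := (IsLocalization.Away.lift (S := L) a ha).toAlgebra
  have : IsScalarTower A L B := .of_algebraMap_eq fun x ↦ (IsLocalization.Away.lift_eq a ha x).symm
  exact Module.Flat.of_linearEquiv (AlgebraTensorModule.cancelBaseChange A L B B M).symm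

/-- Flatness of the cokernel, not of `B`, preserves injectivity; `B` may thus be the field of a
geometric point. -/
lemma exists_lTensor_injective (A : Type u) {R S : Type u} [CommRing A] [IsDomain A]
    [IsNoetherianRing A] [CommRing R] [CommRing S] [Algebra A R] [Algebra R S] [Algebra A S]
    [IsScalarTower A R S] [Algebra.FiniteType A R] [Algebra.FiniteType R S]
    (h : Function.Injective (algebraMap R S)) :
    ∃ a : A, a ≠ 0 ∧ ∀ (B : Type u) [CommRing B] [Algebra A B], IsUnit (algebraMap A B a) →
      Function.Injective ((IsScalarTower.toAlgHom A R S).toLinearMap.lTensor B) := by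
  obtain ⟨a, ha, hf⟩ := genericallyFlat_quotient_range A (R := R) (S := S)
  have h₁ : Function.Exact (Algebra.linearMap R S) (LinearMap.range (Algebra.linearMap R S)).mkQ :=
    LinearMap.exact_map_mkQ_range _
  have h₂ := Submodule.mkQ_surjective (LinearMap.range (Algebra.linearMap R S))
  refine ⟨a, ha, fun B _ _ hβ ↦ ?_⟩
  exact hf.lTensor_injective (IsScalarTower.toAlgHom A R S).toLinearMap
    ((LinearMap.range (Algebra.linearMap R S)).mkQ.restrictScalars A) h h₂ h₁ B hβ

namespace AlgebraicGeometry

lemma isSchemeTheoreticallyDominant_SpecMap_iff {R S : CommRingCat.{u}} (φ : R ⟶ S) :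
    IsSchemeTheoreticallyDominant (Spec.map φ) ↔ Function.Injective φ.hom := by
  have e : (Spec.map φ).appTop = (Scheme.ΓSpecIso R).hom ≫ φ ≫ (Scheme.ΓSpecIso S).inv := by
    rw [← Scheme.ΓSpecIso_naturality_assoc, Iso.hom_inv_id, Category.comp_id]
  have h : Function.Injective (Spec.map φ).appTop.hom ↔ Function.Injective φ.hom := by
    rw [e]
    simp only [CommRingCat.hom_comp, RingHom.coe_comp]
    have h₁ : Function.Injective (Scheme.ΓSpecIso S).inv.hom :=
      (ConcreteCategory.bijective_of_isIso (Scheme.ΓSpecIso S).inv).1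
    have h₂ : Function.Bijective (Scheme.ΓSpecIso R).hom.hom :=
      ConcreteCategory.bijective_of_isIso (Scheme.ΓSpecIso R).hom
    rw [Function.Injective.of_comp_iff' _ h₂, h₁.of_comp_iff]
  rw [← h]
  refine ⟨fun _ ↦ (Spec.map φ).app_injective ⊤, fun h ↦ ⟨?_⟩⟩
  exact Scheme.IdealSheafData.ext_of_isAffine (by
    rw [(Spec.map φ).ker_apply ⟨⊤, isAffineOpen_top _⟩]
    exact (RingHom.injective_iff_ker_eq_bot _).mp h)

/-- A morphism is scheme-theoretically dominant if it is so after lifting along a cover of its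
target. -/
lemma IsSchemeTheoreticallyDominant.of_openCover {X Y : Scheme.{u}} (f : X ⟶ Y) (𝒰 : Y.OpenCover)
    {W : 𝒰.I₀ → Scheme.{u}} (w : ∀ i, W i ⟶ X) (v : ∀ i, W i ⟶ 𝒰.X i)
    (h : ∀ i, w i ≫ f = v i ≫ 𝒰.f i) (hv : ∀ i, IsSchemeTheoreticallyDominant (v i)) :
    IsSchemeTheoreticallyDominant f := by
  refine ⟨eq_bot_iff.mpr ?_⟩
  rw [← Scheme.Hom.ker_eq_bot_of_isIso (𝟙 Y), ← (𝟙 Y : Y ⟶ Y).iInf_ker_openCover_map_comp 𝒰]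
  refine le_iInf fun i ↦ ?_
  rw [Category.comp_id, ← Scheme.IdealSheafData.map_bot (𝒰.f i), ← (v i).ker_eq_bot,
    ← Scheme.Hom.ker_comp, ← h]
  exact Scheme.Hom.le_ker_comp _ _

lemma isSchemeTheoreticallyDominant_sigmaDesc {X : Scheme.{u}} (𝒰 : X.OpenCover) :
    IsSchemeTheoreticallyDominant (Limits.Sigma.desc 𝒰.f) :=
  .of_openCover _ 𝒰 (fun i ↦ Limits.Sigma.ι 𝒰.X i) (fun i ↦ 𝟙 _) (by simp) fun _ ↦ inferInstance

/-- `q : P ⟶ U` is scheme-theoretically dominant after base change along `g : T ⟶ S`. -/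
def DominantOver {P U S T : Scheme.{u}} (q : P ⟶ U) (y : U ⟶ S) (g : T ⟶ S) : Prop :=
  ∀ ⦃U' P' : Scheme.{u}⦄ (u' : U' ⟶ U) (t : U' ⟶ T) (p' : P' ⟶ P) (q' : P' ⟶ U'),
    IsPullback u' t y g → IsPullback p' q' q u' → IsSchemeTheoreticallyDominant q'

lemma DominantOver.of_isPullback {P U S T : Scheme.{u}} {q : P ⟶ U} {y : U ⟶ S} {g : T ⟶ S}
    {U' P' : Scheme.{u}} (u' : U' ⟶ U) (t : U' ⟶ T) (p' : P' ⟶ P) (q' : P' ⟶ U')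
    (h₁ : IsPullback u' t y g) (h₂ : IsPullback p' q' q u')
    (h : IsSchemeTheoreticallyDominant q') : DominantOver q y g := by
  intro U'' P'' u'' t'' p'' q'' h₁' h₂'
  let e := h₁'.isoIsPullback _ _ h₁
  have he : e.hom ≫ u' = u'' := h₁'.isoIsPullback_hom_fst _ _ h₁
  have h₃ : IsPullback p'' (q'' ≫ e.hom) q u' :=
    h₂'.of_iso (Iso.refl _) (Iso.refl _) e (Iso.refl _) (by simp) (by simp) (by simp) (by simp [he])
  have h4 : q'' = (h₃.isoIsPullback _ _ h₂).hom ≫ q' ≫ e.inv := by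
    rw [h₃.isoIsPullback_hom_snd_assoc, Category.assoc, e.hom_inv_id, Category.comp_id]
  rw [h4]
  infer_instance

/-- The kernel of a composite contains the kernel of its second factor, so dominance may be tested
on any source mapping to `P`. -/
lemma DominantOver.of_comp {V P U S T : Scheme.{u}} (v : V ⟶ P) {q : P ⟶ U} {y : U ⟶ S} {g : T ⟶ S}
    (h : DominantOver (v ≫ q) y g) : DominantOver q y g := by
  intro U' P' u' t p' q' h₁ h₂
  have h₃ := IsPullback.of_hasPullback v p'
  have := h u' t _ _ h₁ (h₃.flip.paste_horiz h₂.flip).flip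
  refine ⟨eq_bot_iff.mpr ?_⟩
  rw [← Scheme.Hom.ker_eq_bot (Limits.pullback.snd v p' ≫ q')]
  exact Scheme.Hom.le_ker_comp _ _

lemma DominantOver.of_openCover {P U S T : Scheme.{u}} {q : P ⟶ U} {y : U ⟶ S} {g : T ⟶ S}
    (𝒰 : U.OpenCover)
    (h : ∀ i, DominantOver (Limits.pullback.snd q (𝒰.f i)) (𝒰.f i ≫ y) g) :
    DominantOver q y g := by
  intro U' P' u' t p' q' h₁ h₂
  let w (i) := Limits.pullback.fst p' (Limits.pullback.fst q (𝒰.f i))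
  have h₃ (i) := (IsPullback.of_hasPullback p' (Limits.pullback.fst q (𝒰.f i))).paste_horiz h₂.flip
  let v (i) : Limits.pullback p' (Limits.pullback.fst q (𝒰.f i)) ⟶ Limits.pullback u' (𝒰.f i) :=
    Limits.pullback.lift (w i ≫ q') (Limits.pullback.snd _ _ ≫ Limits.pullback.snd q (𝒰.f i)) (by
      rw [Category.assoc, ← h₂.w, Limits.pullback.condition_assoc, Category.assoc,
        Limits.pullback.condition])
  have hv (i) : v i ≫ Limits.pullback.fst _ _ = w i ≫ q' := Limits.pullback.lift_fst _ _ _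
  have h₄ (i) : IsPullback (v i ≫ Limits.pullback.fst _ _) (Limits.pullback.snd _ _) u'
      (Limits.pullback.snd q (𝒰.f i) ≫ 𝒰.f i) := by
    rw [hv, ← Limits.pullback.condition]
    exact h₃ i
  exact .of_openCover q' (𝒰.pullback₁ u') w v (fun i ↦ (hv i).symm) fun i ↦
    h i _ _ (Limits.pullback.snd _ _) (v i)
      ((IsPullback.of_hasPullback u' (𝒰.f i)).flip.paste_vert h₁)
      ((h₄ i).of_right (Limits.pullback.lift_snd _ _ _)
        (IsPullback.of_hasPullback u' (𝒰.f i))).flip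

lemma DominantOver.of_iso {P U V S T : Scheme.{u}} {q : P ⟶ U} {y : U ⟶ S} {g : T ⟶ S}
    (e : U ≅ V) (h : DominantOver (q ≫ e.hom) (e.inv ≫ y) g) : DominantOver q y g := by
  intro U' P' u' t p' q' h₁ h₂
  refine h (u' ≫ e.hom) t p' q' ?_ ?_
  · exact h₁.of_iso (Iso.refl _) e (Iso.refl _) (Iso.refl _) (by simp) (by simp) (by simp) (by simp)
  · exact h₂.of_iso (Iso.refl _) (Iso.refl _) (Iso.refl _) e (by simp) (by simp) (by simp) (by simp)

lemma DominantOver.of_algebra {A R S B : Type u} [CommRing A] [CommRing R] [CommRing S] [CommRing B]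
    [Algebra A R] [Algebra R S] [Algebra A S] [IsScalarTower A R S] [Algebra A B]
    (h : Function.Injective ((IsScalarTower.toAlgHom A R S).toLinearMap.lTensor B)) :
    DominantOver (Spec.map (CommRingCat.ofHom (algebraMap R S)))
      (Spec.map (CommRingCat.ofHom (algebraMap A R)))
      (Spec.map (CommRingCat.ofHom (algebraMap A B))) := by
  have h₁ := isPullback_SpecMap_of_isPushout _ _ _ _ (CommRingCat.isPushout_tensorProduct A B R)
  have h₂ := isPullback_SpecMap_of_isPushout _ _ _ _ (CommRingCat.isPushout_tensorProduct A B S)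
  let φ : B ⊗[A] R →ₐ[B] B ⊗[A] S := Algebra.TensorProduct.map (.id B B)
    (IsScalarTower.toAlgHom A R S)
  refine .of_isPullback _ _ _ (Spec.map (CommRingCat.ofHom φ.toRingHom)) h₁.flip
    (IsPullback.of_right (h₁₂ := Spec.map (CommRingCat.ofHom
      (Algebra.TensorProduct.includeLeftRingHom : B →+* B ⊗[A] R)))
      (v₁₁ := Spec.map (CommRingCat.ofHom
        (Algebra.TensorProduct.includeRight : S →ₐ[A] B ⊗[A] S).toRingHom)) ?_ ?_ h₁).flip ?_
  · convert! h₂ using 1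
    · rw [← Spec.map_comp, ← CommRingCat.ofHom_comp]
      congr 2
      ext; simp [φ]
    · rw [← Spec.map_comp, ← CommRingCat.ofHom_comp, ← IsScalarTower.algebraMap_eq]
  · rw [← Spec.map_comp, ← CommRingCat.ofHom_comp, ← Spec.map_comp, ← CommRingCat.ofHom_comp]
    congr 2
  · rw [isSchemeTheoreticallyDominant_SpecMap_iff]
    exact h

lemma isUnit_of_isUnit_prod {A B : Type*} [CommRing A] [CommRing B] (φ : A →+* B) {I : Type*}
    {s : Finset I} {a : I → A} (h : IsUnit (φ (∏ i ∈ s, a i))) {i : I} (hi : i ∈ s) :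
    IsUnit (φ (a i)) :=
  isUnit_of_dvd_unit (map_dvd φ (Finset.dvd_prod_of_mem a hi)) h

instance : IsZariskiLocalAtSource @LocallyOfFiniteType.{u} :=
  HasRingHomProperty.instIsZariskiLocalAtSource

instance : IsZariskiLocalAtSource @Flat.{u} :=
  HasRingHomProperty.instIsZariskiLocalAtSource

lemma exists_dominantOver_algebraMap (A R S : Type u) [CommRing A] [IsDomain A] [IsNoetherianRing A]
    [CommRing R] [CommRing S] [Algebra A R] [Algebra R S] [Algebra A S] [IsScalarTower A R S]
    [Algebra.FiniteType A R] [Algebra.FiniteType R S]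
    (h : Function.Injective (algebraMap R S)) :
    ∃ a : A, a ≠ 0 ∧ ∀ (B : Type u) [CommRing B] [Algebra A B], IsUnit (algebraMap A B a) →
      DominantOver (Spec.map (CommRingCat.ofHom (algebraMap R S)))
        (Spec.map (CommRingCat.ofHom (algebraMap A R)))
        (Spec.map (CommRingCat.ofHom (algebraMap A B))) := by
  obtain ⟨a, ha, hf⟩ := exists_lTensor_injective A h
  exact ⟨a, ha, fun B _ _ hβ ↦ .of_algebra (hf B hβ)⟩

section

variable {A : Type u} [CommRing A] [IsDomain A] [IsNoetherianRing A]

lemma exists_dominantOver_of_SpecMap {R S : Type u} [CommRing R] [CommRing S] (φ : R →+* S)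
    (α : A →+* R) (hφ : φ.FiniteType) (hα : α.FiniteType) (hφ' : Function.Injective φ) :
    ∃ a : A, a ≠ 0 ∧ ∀ (B : Type u) [CommRing B] (β : A →+* B), IsUnit (β a) →
      DominantOver (Spec.map (CommRingCat.ofHom φ)) (Spec.map (CommRingCat.ofHom α))
        (Spec.map (CommRingCat.ofHom β)) := by
  let := φ.toAlgebra
  let := α.toAlgebra
  let := (φ.comp α).toAlgebra
  have : IsScalarTower A R S := .of_algebraMap_eq' rfl
  have : Algebra.FiniteType A R := hα
  have : Algebra.FiniteType R S := hφ
  obtain ⟨a, ha, h⟩ := exists_dominantOver_algebraMap A R S hφ'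
  refine ⟨a, ha, fun B _ β hβ ↦ ?_⟩
  let := β.toAlgebra
  exact h B hβ

variable {P Y : Scheme.{u}}

/-- A finite disjoint union of affine opens covering `P` is affine and dominates `P`, so the
question becomes one about an injective ring homomorphism. -/
lemma exists_dominantOver_of_isAffine [IsAffine Y] (q : P ⟶ Y) (y : Y ⟶ Spec (.of A))
    [IsSchemeTheoreticallyDominant q] [QuasiCompact q] [LocallyOfFiniteType q]
    [LocallyOfFiniteType y] :
    ∃ a : A, a ≠ 0 ∧ ∀ (B : Type u) [CommRing B] (β : A →+* B), IsUnit (β a) →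
      DominantOver q y (Spec.map (CommRingCat.ofHom β)) := by
  have : CompactSpace P := QuasiCompact.compactSpace_of_compactSpace q
  let 𝒰 := P.affineCover.finiteSubcover
  let d : ∐ 𝒰.X ⟶ P := Limits.Sigma.desc 𝒰.f
  have : IsSchemeTheoreticallyDominant d := isSchemeTheoreticallyDominant_sigmaDesc 𝒰
  have : LocallyOfFiniteType d :=
    have h (i : 𝒰.I₀) : LocallyOfFiniteType (Limits.Sigma.ι 𝒰.X i ≫ d) := by
      rw [Limits.Sigma.ι_desc]
      infer_instance
    IsZariskiLocalAtSource.of_openCover (sigmaOpenCover 𝒰.X) h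
  let v := (∐ 𝒰.X).isoSpec.inv ≫ d ≫ q ≫ Y.isoSpec.hom
  obtain ⟨φ, hφ⟩ := Spec.map_surjective v
  obtain ⟨α, hα⟩ := Spec.map_surjective (Y.isoSpec.inv ≫ y)
  obtain ⟨a, ha, h⟩ := exists_dominantOver_of_SpecMap φ.hom α.hom
    (HasRingHomProperty.Spec_iff (P := @LocallyOfFiniteType).mp (by rw [hφ]; infer_instance))
    (HasRingHomProperty.Spec_iff (P := @LocallyOfFiniteType).mp (by rw [hα]; infer_instance))
    ((isSchemeTheoreticallyDominant_SpecMap_iff φ).mp (by rw [hφ]; infer_instance))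
  refine ⟨a, ha, fun B _ β hβ ↦ ?_⟩
  refine DominantOver.of_iso Y.isoSpec ?_
  rw [← hα]
  refine DominantOver.of_comp ((∐ 𝒰.X).isoSpec.inv ≫ d) ?_
  rw [Category.assoc]
  change DominantOver v _ _
  rw [← hφ]
  exact h B β hβ

/-- A scheme-theoretically dominant morphism of finite type schemes over a noetherian domain `A`
remains so after base change to any `A`-algebra in which a suitable nonzero `a : A` is
invertible. -/
lemma exists_dominantOver (q : P ⟶ Y) (y : Y ⟶ Spec (.of A))
    [IsSchemeTheoreticallyDominant q] [QuasiCompact q] [LocallyOfFiniteType q]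
    [LocallyOfFiniteType y] [QuasiCompact y] :
    ∃ a : A, a ≠ 0 ∧ ∀ (B : Type u) [CommRing B] (β : A →+* B), IsUnit (β a) →
      DominantOver q y (Spec.map (CommRingCat.ofHom β)) := by
  have : CompactSpace Y := QuasiCompact.compactSpace_of_compactSpace y
  let 𝒰 := Y.affineCover.finiteSubcover
  choose a ha h using fun i ↦ exists_dominantOver_of_isAffine
    (Limits.pullback.snd q (𝒰.f i)) (𝒰.f i ≫ y)
  refine ⟨∏ i, a i, Finset.prod_ne_zero_iff.mpr fun i _ ↦ ha i, fun B _ β hβ ↦ ?_⟩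
  exact .of_openCover 𝒰 fun i ↦ h i B β (isUnit_of_isUnit_prod β hβ (Finset.mem_univ i))

/-- **Generic flatness** for schemes. -/
lemma exists_flat (y : Y ⟶ Spec (.of A)) [LocallyOfFiniteType y] [QuasiCompact y] :
    ∃ a : A, a ≠ 0 ∧ ∀ (B : Type u) [CommRing B] (β : A →+* B), IsUnit (β a) →
      ∀ (Y' : Scheme.{u}) (p : Y' ⟶ Y) (y' : Y' ⟶ Spec (.of B)),
        IsPullback p y' y (Spec.map (CommRingCat.ofHom β)) → Flat y' := by
  have : CompactSpace Y := QuasiCompact.compactSpace_of_compactSpace y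
  let 𝒰 := Y.affineCover.finiteSubcover
  choose α hα using fun i ↦ Spec.map_surjective ((𝒰.X i).isoSpec.inv ≫ 𝒰.f i ≫ y)
  have hα' (i) : (α i).hom.FiniteType :=
    HasRingHomProperty.Spec_iff (P := @LocallyOfFiniteType).mp (by rw [hα]; infer_instance)
  choose a ha h using fun i ↦
    letI := (α i).hom.toAlgebra
    have : Algebra.FiniteType A Γ(𝒰.X i, ⊤) := hα' i
    genericallyFlat_of_finiteType A (R := Γ(𝒰.X i, ⊤))
  refine ⟨∏ i, a i, Finset.prod_ne_zero_iff.mpr fun i _ ↦ ha i, fun B _ β hβ Y' p y' H ↦ ?_⟩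
  suffices key : ∀ i : 𝒰.I₀, Flat (Limits.pullback.fst p (𝒰.f i) ≫ y') from
    IsZariskiLocalAtSource.of_openCover (𝒰.pullback₁ p) key
  intro i
  let := β.toAlgebra
  let := (α i).hom.toAlgebra
  have h₁ := (h i).flat_tensorProduct B (isUnit_of_isUnit_prod β hβ (Finset.mem_univ i))
  have h₂ := isPullback_SpecMap_of_isPushout _ _ _ _
    (CommRingCat.isPushout_tensorProduct A B Γ(𝒰.X i, ⊤))
  have h₃ : IsPullback (Limits.pullback.fst p (𝒰.f i) ≫ y')
      (Limits.pullback.snd p (𝒰.f i) ≫ (𝒰.X i).isoSpec.hom) (Spec.map (CommRingCat.ofHom β))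
      (Spec.map (α i)) := by
    rw [hα]
    exact ((IsPullback.of_hasPullback p (𝒰.f i)).flip.paste_vert H).flip.of_iso (Iso.refl _)
      (Iso.refl _) (𝒰.X i).isoSpec (Iso.refl _) (by simp) (by simp) (by simp) (by simp)
  rw [← h₃.isoIsPullback_hom_fst _ _ h₂]
  have : Flat (Spec.map (CommRingCat.ofHom
      (Algebra.TensorProduct.includeLeftRingHom : B →+* B ⊗[A] Γ(𝒰.X i, ⊤)))) :=
    Flat.SpecMap_iff.mpr ((RingHom.flat_algebraMap_iff (R := B) (S := B ⊗[A] Γ(𝒰.X i, ⊤))).mpr h₁)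
  infer_instance

end

end AlgebraicGeometry

end GenericDominance

/-! ### Scheme-theoretic images and closures of images -/

section ClosureOfImage

namespace AlgebraicGeometry

/-- Reducedness of `P` makes the kernel radical, and a radical ideal sheaf is determined by its
support, here the closure of the range. -/
lemma vanishingIdeal_closure_range {P X : Scheme.{u}} (f : P ⟶ X) [QuasiCompact f] [IsReduced P] :
    Scheme.IdealSheafData.vanishingIdeal (.closure (Set.range f)) = f.ker := by
  have h₁ : f.ker.radical = f.ker := by
    refine le_antisymm (fun U ↦ ?_) (Scheme.IdealSheafData.le_radical _)
    change (f.ker.ideal U).radical ≤ _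
    rw [f.ker_apply U]
    exact (Ideal.isRadical_bot.comap (f.app U).hom).radical.le
  rw [← h₁, ← Scheme.IdealSheafData.vanishingIdeal_support]
  congr 1
  ext : 1
  rw [f.support_ker]
  rfl

instance {P X : Scheme.{u}} (f : P ⟶ X) : IsSchemeTheoreticallyDominant f.toImage := by
  refine ⟨(Scheme.isIso_subschemeι_iff_eq_bot _).mp ?_⟩
  refine IsClosedImmersion.isIso_of_ker_eq (f.toImage.ker.subschemeι ≫ f.imageι) f.imageι _ rfl ?_
  rw [Scheme.Hom.ker_comp, Scheme.IdealSheafData.ker_subschemeι, ← Scheme.Hom.ker_comp,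
    f.toImage_imageι, Scheme.Hom.imageι, Scheme.IdealSheafData.ker_subschemeι]

lemma isPullback_comap {X' X : Scheme.{u}} (I : X.IdealSheafData) (π : X' ⟶ X) :
    IsPullback (I.comap π).subschemeι ((I.comapIso π).hom ≫ Limits.pullback.snd _ _) π
      I.subschemeι :=
  (IsPullback.of_hasPullback π I.subschemeι).of_iso (I.comapIso π).symm (Iso.refl _) (Iso.refl _)
    (Iso.refl _) (by simp) (by simp [-Scheme.IdealSheafData.comapIso_hom_snd]) (by simp) (by simp)

variable {A : Type u} [CommRing A] [IsDomain A] [IsNoetherianRing A] {P X : Scheme.{u}}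

/-- Factor `f` through its image. After base change the first factor is still dominant and the
second is still a closed immersion, so the kernel of the composite is the pulled-back ideal. -/
lemma exists_ker_comap (f : P ⟶ X) (x : X ⟶ Spec (.of A)) [QuasiCompact f] [LocallyOfFiniteType f]
    [LocallyOfFiniteType x] [QuasiCompact x] :
    ∃ a : A, a ≠ 0 ∧ ∀ (B : Type u) [CommRing B] (β : A →+* B), IsUnit (β a) →
      ∀ (P' X' : Scheme.{u}) (p : P' ⟶ P) (π : X' ⟶ X) (f' : P' ⟶ X') (x' : X' ⟶ Spec (.of B)),
        IsPullback π x' x (Spec.map (CommRingCat.ofHom β)) → IsPullback p f' f π →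
        f'.ker = f.ker.comap π := by
  have : LocallyOfFiniteType f.toImage := by
    have : LocallyOfFiniteType (f.toImage ≫ f.imageι) := by rwa [f.toImage_imageι]
    exact locallyOfFiniteType_of_comp _ f.imageι
  obtain ⟨a, ha, h⟩ := exists_dominantOver f.toImage (f.imageι ≫ x)
  refine ⟨a, ha, fun B _ β hβ P' X' p π f' x' H₁ H₂ ↦ ?_⟩
  have h₁ := IsPullback.of_hasPullback π f.imageι
  let q : P' ⟶ Limits.pullback π f.imageι := Limits.pullback.lift f' (p ≫ f.toImage) (by
    rw [Category.assoc, f.toImage_imageι, H₂.w])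
  have hq : q ≫ Limits.pullback.fst π f.imageι = f' := Limits.pullback.lift_fst _ _ _
  have h₂ : IsPullback p q f.toImage (Limits.pullback.snd π f.imageι) := by
    refine IsPullback.of_right (h₁₂ := Limits.pullback.fst π f.imageι) ?_
      (Limits.pullback.lift_snd _ _ _) h₁ |>.flip
    rw [hq, f.toImage_imageι]
    exact H₂.flip
  have := h B β hβ _ _ p q (h₁.flip.paste_vert H₁) h₂
  rw [← hq, Scheme.Hom.ker_comp, q.ker_eq_bot, Scheme.IdealSheafData.map_bot]
  exact ((Scheme.IdealSheafData.ker_fst_of_isClosedImmersion _ _).trans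
    (by rw [Scheme.Hom.imageι, Scheme.IdealSheafData.ker_subschemeι]))

/-- The formation of the closure of the image of a morphism of finite type schemes over a noetherian
domain, whose source is geometrically integral, commutes generically with base change. -/
theorem exists_closure_range_comap (f : P ⟶ X) (x : X ⟶ Spec (.of A)) [QuasiCompact f]
    [LocallyOfFiniteType f] [LocallyOfFiniteType x] [QuasiCompact x]
    [GeometricallyIntegral (f ≫ x)] :
    ∃ a : A, a ≠ 0 ∧ ∀ (B : Type u) [CommRing B] [IsDomain B] [IsNoetherianRing B] (β : A →+* B),
      IsUnit (β a) →
      ∀ (P' X' : Scheme.{u}) (p : P' ⟶ P) (π : X' ⟶ X) (f' : P' ⟶ X') (x' : X' ⟶ Spec (.of B)),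
        IsPullback π x' x (Spec.map (CommRingCat.ofHom β)) → IsPullback p f' f π →
        IsIntegral P' ∧ Flat ((f.ker.comap π).subschemeι ≫ x') ∧
        Scheme.IdealSheafData.vanishingIdeal (.closure (Set.range f')) = f.ker.comap π := by
  -- `a` controls the kernel and `b` the flatness of the image. `c` makes the source flat, so that
  -- geometrically integral fibres give an integral total space.
  obtain ⟨a, ha, h⟩ := exists_ker_comap f x
  obtain ⟨b, hb, h'⟩ := exists_flat (f.imageι ≫ x)
  obtain ⟨c, hc, h''⟩ := exists_flat (f ≫ x)
  refine ⟨a * b * c, mul_ne_zero (mul_ne_zero ha hb) hc,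
    fun B _ _ _ β hβ P' X' p π f' x' H₁ H₂ ↦ ?_⟩
  rw [map_mul, map_mul, IsUnit.mul_iff, IsUnit.mul_iff] at hβ
  obtain ⟨⟨ha', hb'⟩, hc'⟩ := hβ
  have H₃ := H₂.flip.paste_horiz H₁.flip
  have : Flat (f' ≫ x') := h'' B β hc' _ _ _ H₃.flip
  have : GeometricallyIntegral (f' ≫ x') := MorphismProperty.of_isPullback H₃.flip ‹_›
  have : LocallyOfFiniteType (f' ≫ x') := MorphismProperty.of_isPullback H₃.flip
    (inferInstanceAs (LocallyOfFiniteType (f ≫ x)))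
  have hP' : IsIntegral P' := GeometricallyIntegral.isIntegral_of_isLocallyNoetherian (f' ≫ x')
  have : QuasiCompact f' := MorphismProperty.of_isPullback H₂ ‹_›
  refine ⟨hP', ?_, ?_⟩
  · exact h' B β hb' _ _ _ ((isPullback_comap f.ker π).flip.paste_vert H₁)
  · rw [vanishingIdeal_closure_range]
    exact h B β ha' _ _ p π f' x' H₁ H₂

end AlgebraicGeometry

end ClosureOfImage

/-! ### Folds over `Fin n` and geometric integrality of products -/

lemma Fin.foldr_rel {n : ℕ} {α β : Type*} (r : α → β → Prop) {f : Fin n → α → α}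
    {g : Fin n → β → β} {x : α} {y : β} (h : ∀ i a b, r a b → r (f i a) (g i b)) (hxy : r x y) :
    r (Fin.foldr n f x) (Fin.foldr n g y) := by
  induction n with
  | zero => simpa using hxy
  | succ n ih =>
    rw [Fin.foldr_succ, Fin.foldr_succ]
    exact h 0 _ _ (ih fun i ↦ h i.succ)

lemma Fin.foldr_induction {n : ℕ} {α : Type*} (r : α → Prop) {f : Fin n → α → α}
    {x : α} (h : ∀ i a, r a → r (f i a)) (hx : r x) : r (Fin.foldr n f x) :=
  Fin.foldr_rel (β := Unit) (g := fun _ a ↦ a) (y := ()) (fun a _ ↦ r a) (fun i a _ ↦ h i a) hx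

namespace AlgebraicGeometry

/-- Geometric integrality of fibre products. -/
lemma GeometricallyIntegral.pullback_fst_comp {X Y S : Scheme.{u}} (f : X ⟶ S) (g : Y ⟶ S)
    [GeometricallyIntegral f] [GeometricallyIntegral g] [LocallyOfFiniteType f]
    [LocallyOfFiniteType g] : GeometricallyIntegral (Limits.pullback.fst f g ≫ f) := by
  refine ⟨fun K _ s Z p q h ↦ ?_⟩
  have hf := IsPullback.of_hasPullback f s
  have hg := IsPullback.of_hasPullback g s
  have hfg := IsPullback.of_hasPullback (Limits.pullback.fst f g) (Limits.pullback.fst f s)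
  have : IsIntegral (Limits.pullback f s) :=
    GeometricallyIntegral.isIntegral_of_isLocallyNoetherian (Limits.pullback.snd f s)
  have : IsLocallyNoetherian (Limits.pullback f s) :=
    LocallyOfFiniteType.isLocallyNoetherian (Limits.pullback.snd f s)
  have h₁ := hfg.paste_horiz (IsPullback.of_hasPullback f g).flip
  let w := Limits.pullback.lift (f := g) (g := s) _ _
    (h₁.w.trans (by rw [Limits.pullback.condition, ← Category.assoc]))
  have h₂ : IsPullback w (Limits.pullback.snd (Limits.pullback.fst f g) (Limits.pullback.fst f s))
      (Limits.pullback.snd g s) (Limits.pullback.snd f s) := by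
    refine IsPullback.of_right ?_ (Limits.pullback.lift_snd _ _ _) hg
    rw [Limits.pullback.lift_fst, ← Limits.pullback.condition]
    exact h₁
  -- This projection is a base change of a morphism to the spectrum of a field, hence flat; with
  -- geometrically integral fibres over an integral noetherian base, its source is integral.
  have : Flat (Limits.pullback.snd (Limits.pullback.fst f g) (Limits.pullback.fst f s)) :=
    MorphismProperty.of_isPullback h₂ inferInstance
  have : IsIntegral (Limits.pullback (Limits.pullback.fst f g) (Limits.pullback.fst f s)) :=
    GeometricallyIntegral.isIntegral_of_isLocallyNoetherian
      (Limits.pullback.snd (Limits.pullback.fst f g) (Limits.pullback.fst f s))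
  exact IsIntegral.of_isIso (h.isoIsPullback _ _ (hfg.paste_vert hf)).inv

end AlgebraicGeometry

/-! ### Cartesian morphisms of action data -/

section Cart

/-- Base change commutes with products. -/
lemma isPullback_tensor {S T : Scheme.{u}} {g : T ⟶ S} {A B : Over T} {A' B' : Over S}
    {a : A.left ⟶ A'.left} {b : B.left ⟶ B'.left} {m : (A ⊗ B).left ⟶ (A' ⊗ B').left}
    (ha : IsPullback a A.hom A'.hom g) (hb : IsPullback b B.hom B'.hom g)
    (h₁ : m ≫ (SemiCartesianMonoidalCategory.fst A' B').left =
      (SemiCartesianMonoidalCategory.fst A B).left ≫ a)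
    (h₂ : m ≫ (SemiCartesianMonoidalCategory.snd A' B').left =
      (SemiCartesianMonoidalCategory.snd A B).left ≫ b) :
    IsPullback m (A ⊗ B).hom (A' ⊗ B').hom g := by
  have h : IsPullback m (SemiCartesianMonoidalCategory.fst A B).left
      (SemiCartesianMonoidalCategory.fst A' B').left a := by
    refine IsPullback.of_right (h₁₂ := (SemiCartesianMonoidalCategory.snd A' B').left)
      (h₂₂ := A'.hom) (v₁₃ := B'.hom) ?_ h₁ (IsPullback.of_hasPullback A'.hom B'.hom).flip
    rw [h₂, ha.w]
    exact (IsPullback.of_hasPullback A.hom B.hom).flip.paste_horiz hb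
  exact h.paste_vert ha

lemma exists_tensor_left {S T : Scheme.{u}} {g : T ⟶ S} {A B : Over T} {A' B' : Over S}
    {a : A.left ⟶ A'.left} {b : B.left ⟶ B'.left}
    (ha : a ≫ A'.hom = A.hom ≫ g) (hb : b ≫ B'.hom = B.hom ≫ g) :
    ∃ m : (A ⊗ B).left ⟶ (A' ⊗ B').left,
      m ≫ (SemiCartesianMonoidalCategory.fst A' B').left =
        (SemiCartesianMonoidalCategory.fst A B).left ≫ a ∧
      m ≫ (SemiCartesianMonoidalCategory.snd A' B').left =
        (SemiCartesianMonoidalCategory.snd A B).left ≫ b := by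
  refine ⟨Limits.pullback.lift ((SemiCartesianMonoidalCategory.fst A B).left ≫ a)
    ((SemiCartesianMonoidalCategory.snd A B).left ≫ b) ?_, Limits.pullback.lift_fst _ _ _,
    Limits.pullback.lift_snd _ _ _⟩
  rw [Category.assoc, ha, Category.assoc, hb, Over.w_assoc, Over.w_assoc]

lemma tensor_left_hom_ext {S : Scheme.{u}} {A B : Over S} {W : Scheme.{u}}
    {m m' : W ⟶ (A ⊗ B).left}
    (h₁ : m ≫ (SemiCartesianMonoidalCategory.fst A B).left =
      m' ≫ (SemiCartesianMonoidalCategory.fst A B).left)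
    (h₂ : m ≫ (SemiCartesianMonoidalCategory.snd A B).left =
      m' ≫ (SemiCartesianMonoidalCategory.snd A B).left) : m = m' :=
  Limits.pullback.hom_ext h₁ h₂

namespace ActionData

variable {n : ℕ}

/-- Cartesian morphisms between collections of data over a morphism of the bases. -/
structure Cart {S T : Scheme.{u}} (E : ActionData T n) (D : ActionData S n) (g : T ⟶ S) where
  G : E.G.left ⟶ D.G.left
  X : E.X.left ⟶ D.X.left
  H : ∀ i, (E.H i).left ⟶ (D.H i).left
  Z : E.Z.left ⟶ D.Z.left
  isPullback_G : IsPullback G E.G.hom D.G.hom g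
  isPullback_X : IsPullback X E.X.hom D.X.hom g
  isPullback_H : ∀ i, IsPullback (H i) (E.H i).hom (D.H i).hom g
  isPullback_Z : IsPullback Z E.Z.hom D.Z.hom g
  incl : ∀ i, (E.incl i).left ≫ G = H i ≫ (D.incl i).left
  emb : E.emb.left ≫ X = Z ≫ D.emb.left
  -- The two projections determine `m` uniquely as the product of `G` and `X`, so no particular
  -- construction of it has to be fixed.
  act : ∀ m : (E.G ⊗ E.X).left ⟶ (D.G ⊗ D.X).left,
    m ≫ (SemiCartesianMonoidalCategory.fst D.G D.X).left =
      (SemiCartesianMonoidalCategory.fst E.G E.X).left ≫ G →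
    m ≫ (SemiCartesianMonoidalCategory.snd D.G D.X).left =
      (SemiCartesianMonoidalCategory.snd E.G E.X).left ≫ X →
    E.act.left ≫ X = m ≫ D.act.left

namespace Cart

variable {S T U : Scheme.{u}} {D : ActionData S n} {E : ActionData T n} {F : ActionData U n}
  {g : T ⟶ S} {h : U ⟶ T}

/-- Composition of cartesian morphisms. -/
def comp (d : Cart F E h) (c : Cart E D g) : Cart F D (h ≫ g) where
  G := d.G ≫ c.G
  X := d.X ≫ c.X
  H i := d.H i ≫ c.H i
  Z := d.Z ≫ c.Z
  isPullback_G := d.isPullback_G.paste_horiz c.isPullback_G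
  isPullback_X := d.isPullback_X.paste_horiz c.isPullback_X
  isPullback_H i := (d.isPullback_H i).paste_horiz (c.isPullback_H i)
  isPullback_Z := d.isPullback_Z.paste_horiz c.isPullback_Z
  incl i := by rw [← Category.assoc, d.incl, Category.assoc, c.incl, Category.assoc]
  emb := by rw [← Category.assoc, d.emb, Category.assoc, c.emb, Category.assoc]
  act m h₁ h₂ := by
    obtain ⟨m₁, h₃, h₄⟩ := exists_tensor_left d.isPullback_G.w d.isPullback_X.w
    obtain ⟨m₂, h₅, h₆⟩ := exists_tensor_left c.isPullback_G.w c.isPullback_X.w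
    rw [← Category.assoc, d.act m₁ h₃ h₄, Category.assoc, c.act m₂ h₅ h₆, ← Category.assoc]
    congr 1
    apply tensor_left_hom_ext
    · rw [h₁, Category.assoc, h₅, ← Category.assoc, h₃, Category.assoc]
    · rw [h₂, Category.assoc, h₆, ← Category.assoc, h₄, Category.assoc]

/-- Cartesian morphisms over equal morphisms. -/
def congr {g' : T ⟶ S} (c : Cart E D g) (e : g = g') : Cart E D g' := e ▸ c

lemma congr_X {g' : T ⟶ S} (c : Cart E D g) (e : g = g') : (c.congr e).X = c.X := by
  subst e
  rfl

lemma isPullback_inv_left {A B : Over S} (e : A ≅ B) :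
    IsPullback e.inv.left B.hom A.hom (𝟙 S) :=
  have : IsIso e.inv.left := inferInstanceAs (IsIso ((Over.forget S).map e.inv))
  IsPullback.of_horiz_isIso ⟨by simp⟩

/-- Isomorphisms are cartesian. -/
def ofIso {E' D' : ActionData S n} (e : D'.Iso E') : Cart E' D' (𝟙 S) where
  G := e.G.inv.left
  X := e.X.inv.left
  H i := (e.H i).inv.left
  Z := e.Z.inv.left
  isPullback_G := isPullback_inv_left _
  isPullback_X := isPullback_inv_left _
  isPullback_H _ := isPullback_inv_left _
  isPullback_Z := isPullback_inv_left _
  incl i := by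
    rw [← Over.comp_left, ← Over.comp_left]
    congr 1
    rw [Iso.comp_inv_eq, Category.assoc, e.incl_comp,
      Iso.inv_hom_id_assoc]
  emb := by
    rw [← Over.comp_left, ← Over.comp_left]
    congr 1
    rw [Iso.comp_inv_eq, Category.assoc, e.emb_comp,
      Iso.inv_hom_id_assoc]
  act m h₁ h₂ := by
    have : m = (e.G.inv ⊗ₘ e.X.inv).left := by
      apply tensor_left_hom_ext
      · rw [h₁, ← Over.comp_left, ← Over.comp_left, CartesianMonoidalCategory.tensorHom_fst]
      · rw [h₂, ← Over.comp_left, ← Over.comp_left, CartesianMonoidalCategory.tensorHom_snd]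
    rw [this, ← Over.comp_left, ← Over.comp_left]
    congr 1
    rw [Iso.comp_inv_eq, Category.assoc, e.act_comp,
      MonoidalCategory.tensorHom_comp_tensorHom_assoc]
    simp

lemma isPullback_overPullback (g : T ⟶ S) (A : Over S) :
    IsPullback (Limits.pullback.fst A.hom g) ((Over.pullback g).obj A).hom A.hom g :=
  IsPullback.of_hasPullback _ _

lemma pullback_map_left_fst (g : T ⟶ S) {A B : Over S} (f : A ⟶ B) :
    ((Over.pullback g).map f).left ≫ Limits.pullback.fst B.hom g =
      Limits.pullback.fst A.hom g ≫ f.left := Limits.pullback.lift_fst _ _ _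

/-- The action on a base change is defined through `μ`; comparing projections shows that it lies
over the original action. -/
lemma μ_comp_map_left_fst (g : T ⟶ S) {A B C : Over S} (f : A ⊗ B ⟶ C)
    {m : ((Over.pullback g).obj A ⊗ (Over.pullback g).obj B).left ⟶ (A ⊗ B).left}
    (h₁ : m ≫ (SemiCartesianMonoidalCategory.fst A B).left =
      (SemiCartesianMonoidalCategory.fst ((Over.pullback g).obj A) ((Over.pullback g).obj B)).left ≫
        Limits.pullback.fst A.hom g)
    (h₂ : m ≫ (SemiCartesianMonoidalCategory.snd A B).left =
      (SemiCartesianMonoidalCategory.snd ((Over.pullback g).obj A) ((Over.pullback g).obj B)).left ≫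
        Limits.pullback.fst B.hom g) :
    (Functor.LaxMonoidal.μ (Over.pullback g) A B ≫ (Over.pullback g).map f).left ≫
      Limits.pullback.fst C.hom g = m ≫ f.left := by
  rw [Over.comp_left, Category.assoc, pullback_map_left_fst, ← Category.assoc]
  congr 1
  apply tensor_left_hom_ext
  · rw [h₁, Category.assoc, ← pullback_map_left_fst, ← Category.assoc, ← Over.comp_left,
      Functor.Monoidal.μ_fst]
  · rw [h₂, Category.assoc, ← pullback_map_left_fst, ← Category.assoc, ← Over.comp_left,
      Functor.Monoidal.μ_snd]

/-- The projection from the base change is cartesian. -/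
noncomputable def ofBaseChange (D : ActionData S n) (g : T ⟶ S) : Cart (D.baseChange g) D g where
  G := Limits.pullback.fst _ _
  X := Limits.pullback.fst _ _
  H i := Limits.pullback.fst _ _
  Z := Limits.pullback.fst _ _
  isPullback_G := isPullback_overPullback g _
  isPullback_X := isPullback_overPullback g _
  isPullback_H _ := isPullback_overPullback g _
  isPullback_Z := isPullback_overPullback g _
  incl i := pullback_map_left_fst g (D.incl i)
  emb := pullback_map_left_fst g D.emb
  act m h₁ h₂ := by
    exact μ_comp_map_left_fst g D.act h₁ h₂

/-- Build the square over the base `g` by induction along the fold, each step being a product of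
cartesian squares; cancelling the cartesian square of `X` turns it into a square over `X`. -/
lemma exists_isPullback_orbitMap (c : Cart E D g) :
    ∃ p : E.orbitMap.left.left ⟶ D.orbitMap.left.left,
      IsPullback p E.orbitMap.hom.left D.orbitMap.hom.left c.X := by
  suffices ∃ p : E.orbitMap.left.left ⟶ D.orbitMap.left.left,
      IsPullback p E.orbitMap.left.hom D.orbitMap.left.hom g ∧
      p ≫ D.orbitMap.hom.left = E.orbitMap.hom.left ≫ c.X by
    obtain ⟨p, hp, h⟩ := this
    refine ⟨p, IsPullback.of_bot ?_ h c.isPullback_X⟩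
    rwa [Over.w, Over.w]
  refine Fin.foldr_rel (fun (a : Over E.X) (b : Over D.X) ↦ ∃ p : a.left.left ⟶ b.left.left,
    IsPullback p a.left.hom b.left.hom g ∧ p ≫ b.hom.left = a.hom.left ≫ c.X) ?_
    ⟨c.Z, c.isPullback_Z, c.emb.symm⟩
  rintro i a b ⟨p, hp, h⟩
  obtain ⟨m, h₁, h₂⟩ := exists_tensor_left (c.isPullback_H i).w hp.w
  refine ⟨m, isPullback_tensor (c.isPullback_H i) hp h₁ h₂, ?_⟩
  obtain ⟨m', h₃, h₄⟩ := exists_tensor_left c.isPullback_G.w c.isPullback_X.w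
  change m ≫ ((D.incl i ⊗ₘ b.hom) ≫ D.act).left = ((E.incl i ⊗ₘ a.hom) ≫ E.act).left ≫ c.X
  rw [Over.comp_left, Over.comp_left, Category.assoc, c.act m' h₃ h₄, ← Category.assoc,
    ← Category.assoc]
  congr 1
  apply tensor_left_hom_ext
  · rw [Category.assoc, ← Over.comp_left, CartesianMonoidalCategory.tensorHom_fst, Category.assoc,
      h₃, Over.comp_left, ← Category.assoc, h₁, ← Category.assoc, ← Over.comp_left,
      CartesianMonoidalCategory.tensorHom_fst, Over.comp_left, Category.assoc, Category.assoc,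
      c.incl]
  · rw [Category.assoc, ← Over.comp_left, CartesianMonoidalCategory.tensorHom_snd, Category.assoc,
      h₄, Over.comp_left, ← Category.assoc, h₂, ← Category.assoc, ← Over.comp_left,
      CartesianMonoidalCategory.tensorHom_snd, Over.comp_left, Category.assoc, Category.assoc, h]

end Cart

end ActionData

end Cart

/-! ### Orbit closures and base change -/

section OrbitClosure

namespace AlgebraicGeometry

lemma isIntegral_of_isSchemeTheoreticallyDominant {X Y : Scheme.{u}} (f : X ⟶ Y) [QuasiCompact f]
    [IsSchemeTheoreticallyDominant f] [IsIntegral X] : IsIntegral Y := by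
  rw [isIntegral_iff_irreducibleSpace_and_isReduced]
  have := IsSchemeTheoreticallyDominant.isReduced f
  have h : IsIrreducible (Set.univ : Set Y) := by
    rw [← f.denseRange.closure_range, ← Set.image_univ]
    exact ((IrreducibleSpace.isIrreducible_univ X).image f f.continuous.continuousOn).closure
  exact ⟨(irreducibleSpace_def Y).mpr h, this⟩

end AlgebraicGeometry

namespace ActionData

variable {S T : Scheme.{u}} {n : ℕ}

/-- The closure of the image of the orbit map commutes with base change to noetherian domains. -/
def OrbitClosureCommutes (D : ActionData S n) : Prop :=
  ∀ ⦃B : Type u⦄ [CommRing B] [IsDomain B] [IsNoetherianRing B] (g : Spec (.of B) ⟶ S)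
    (E : ActionData (Spec (.of B)) n) (c : Cart E D g),
    IsIntegral E.orbitClosure.left ∧ E.orbitIdeal = D.orbitIdeal.comap c.X

lemma geometricallyIntegral_orbitMap (D : ActionData S n)
    (hZ : GeometricallyIntegral D.Z.hom ∧ LocallyOfFiniteType D.Z.hom ∧ QuasiCompact D.Z.hom)
    (hH : ∀ i, GeometricallyIntegral (D.H i).hom ∧ LocallyOfFiniteType (D.H i).hom ∧
      QuasiCompact (D.H i).hom) :
    GeometricallyIntegral D.orbitMap.left.hom ∧ LocallyOfFiniteType D.orbitMap.left.hom ∧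
      QuasiCompact D.orbitMap.left.hom := by
  refine Fin.foldr_induction (fun a : Over D.X ↦ GeometricallyIntegral a.left.hom ∧
    LocallyOfFiniteType a.left.hom ∧ QuasiCompact a.left.hom) ?_ hZ
  rintro i a ⟨h₁, h₂, h₃⟩
  obtain ⟨h₄, h₅, h₆⟩ := hH i
  have e : (D.H i ⊗ a.left).hom = Limits.pullback.fst (D.H i).hom a.left.hom ≫ (D.H i).hom := rfl
  change GeometricallyIntegral (D.H i ⊗ a.left).hom ∧ LocallyOfFiniteType (D.H i ⊗ a.left).hom ∧
    QuasiCompact (D.H i ⊗ a.left).hom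
  rw [e]
  exact ⟨.pullback_fst_comp _ _, inferInstance, inferInstance⟩

variable {A : Type u} [CommRing A] [IsDomain A] [IsNoetherianRing A]

/-- The element `a` found for `D` also serves every further base change of `E`: all the orbit ideals
are pullbacks of the single kernel over `A`. -/
lemma exists_orbitClosureCommutes (D : ActionData (Spec (.of A)) n)
    (hX : IsOfFinitePresentation D.X.hom)
    (hZ : GeometricallyIntegral D.Z.hom ∧ LocallyOfFiniteType D.Z.hom ∧ QuasiCompact D.Z.hom)
    (hH : ∀ i, GeometricallyIntegral (D.H i).hom ∧ LocallyOfFiniteType (D.H i).hom ∧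
      QuasiCompact (D.H i).hom) :
    ∃ a : A, a ≠ 0 ∧ ∀ (B : Type u) [CommRing B] [IsDomain B] [IsNoetherianRing B] (β : A →+* B)
      (E : ActionData (Spec (.of B)) n) (_ : Cart E D (Spec.map (CommRingCat.ofHom β))),
      IsUnit (β a) → E.OrbitClosureCommutes ∧ Flat E.orbitClosure.hom := by
  obtain ⟨h₁, h₂, h₃⟩ := D.geometricallyIntegral_orbitMap hZ hH
  obtain ⟨_, _, _⟩ := hX
  rw [← Over.w D.orbitMap.hom] at h₁ h₂ h₃
  have : QuasiCompact D.orbitMap.hom.left := .of_comp _ D.X.hom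
  have : LocallyOfFiniteType D.orbitMap.hom.left := locallyOfFiniteType_of_comp _ D.X.hom
  obtain ⟨a, ha, H⟩ := exists_closure_range_comap D.orbitMap.hom.left D.X.hom
  have key (B : Type u) [CommRing B] [IsDomain B] [IsNoetherianRing B] (β : A →+* B)
      (g : Spec (.of B) ⟶ Spec (.of A)) (hg : g = Spec.map (CommRingCat.ofHom β))
      (E : ActionData (Spec (.of B)) n) (c : Cart E D g) (hβ : IsUnit (β a)) :
      IsIntegral E.orbitClosure.left ∧ Flat E.orbitClosure.hom ∧
        E.orbitIdeal = D.orbitMap.hom.left.ker.comap c.X := by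
    subst hg
    obtain ⟨p, hp⟩ := c.exists_isPullback_orbitMap
    obtain ⟨h, h', e⟩ := H B β hβ _ _ p c.X _ E.X.hom c.isPullback_X hp
    have e' : E.orbitIdeal = D.orbitMap.hom.left.ker.comap c.X := e
    have : QuasiCompact E.orbitMap.hom.left := MorphismProperty.of_isPullback hp ‹_›
    refine ⟨?_, ?_, e'⟩
    · have e₁ : E.orbitIdeal = E.orbitMap.hom.left.ker := vanishingIdeal_closure_range _
      change IsIntegral E.orbitIdeal.subscheme
      rw [e₁]
      exact isIntegral_of_isSchemeTheoreticallyDominant E.orbitMap.hom.left.toImage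
    · change Flat (E.orbitIdeal.subschemeι ≫ E.X.hom)
      rw [e']
      exact h'
  refine ⟨a, ha, fun B _ _ _ β E c hβ ↦
    ⟨fun B' _ _ _ g E' c' ↦ ?_, (key B β _ rfl E c hβ).2.1⟩⟩
  obtain ⟨φ, rfl⟩ := Spec.map_surjective g
  obtain ⟨h₁, -, h₂⟩ := key B' (φ.hom.comp β) _ (by rw [← Spec.map_comp]; rfl) E' (c'.comp c)
    (hβ.map φ.hom)
  refine ⟨h₁, ?_⟩
  -- Both ideals come from the kernel for `D`, so functoriality of `comap` compares them.
  rw [(key B β _ rfl E c hβ).2.2, ← Scheme.IdealSheafData.comap_comp, h₂]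
  rfl

section

variable {D : ActionData S n} {B : Type u} [CommRing B] [IsDomain B]
  [IsNoetherianRing B] {g : Spec (.of B) ⟶ S} {E : ActionData (Spec (.of B)) n}

lemma OrbitClosureCommutes.exists_isPullback (hD : D.OrbitClosureCommutes) (c : Cart E D g) :
    ∃ p : E.orbitClosure.left ⟶ D.orbitClosure.left,
    p ≫ D.orbitClosureι.left = E.orbitClosureι.left ≫ c.X ∧
    IsPullback p E.orbitClosure.hom D.orbitClosure.hom g := by
  have key (I : E.X.left.IdealSheafData) (hI : I = D.orbitIdeal.comap c.X) :
      ∃ p : I.subscheme ⟶ D.orbitIdeal.subscheme, p ≫ D.orbitIdeal.subschemeι =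
        I.subschemeι ≫ c.X ∧
        IsPullback p (I.subschemeι ≫ E.X.hom) (D.orbitIdeal.subschemeι ≫ D.X.hom) g := by
    subst hI
    have h := isPullback_comap D.orbitIdeal c.X
    exact ⟨_, h.w.symm, h.flip.paste_vert c.isPullback_X⟩
  exact key _ (hD g E c).2

lemma OrbitClosureCommutes.exists_iso (hD : D.OrbitClosureCommutes) (c : Cart E D g)
    (j : (Over.pullback g).obj D.X ⟶ E.X)
    (hj : j.left ≫ c.X = Limits.pullback.fst D.X.hom g) :
    ∃ e : (Over.pullback g).obj D.orbitClosure ≅ E.orbitClosure,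
      e.hom ≫ E.orbitClosureι = (Over.pullback g).map D.orbitClosureι ≫ j := by
  obtain ⟨p, hp, h⟩ := hD.exists_isPullback c
  let e := (IsPullback.of_hasPullback D.orbitClosure.hom g).isoIsPullback _ _ h
  have he₁ : e.hom ≫ p = Limits.pullback.fst _ _ := IsPullback.isoIsPullback_hom_fst ..
  have he₂ : e.hom ≫ E.orbitClosure.hom = Limits.pullback.snd _ _ :=
    IsPullback.isoIsPullback_hom_snd ..
  refine ⟨Over.isoMk e he₂, ?_⟩
  ext : 1
  apply c.isPullback_X.hom_ext
  · rw [Over.comp_left, Over.comp_left, Category.assoc, Category.assoc, hj,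
      Cart.pullback_map_left_fst, ← hp, ← he₁, Category.assoc]
    rfl
  · rw [Over.w, Over.w]

/-- A field is a noetherian domain, so the fibre over it is again an orbit closure, integral by
hypothesis. -/
lemma OrbitClosureCommutes.geometricallyIntegral (hD : D.OrbitClosureCommutes) :
    GeometricallyIntegral D.orbitClosure.hom := by
  refine ⟨fun K _ y Z p q h ↦ ?_⟩
  obtain ⟨p', -, h'⟩ := hD.exists_isPullback (Cart.ofBaseChange D y)
  have := (hD y _ (Cart.ofBaseChange D y)).1
  exact IsIntegral.of_isIso (h.isoIsPullback _ _ h').inv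

end

end ActionData

end OrbitClosure

/-! ### Ultraproducts of rings -/

section Ultraproduct

variable {J : Type*} (U : Ultrafilter J) (V K : J → Type*) [∀ i, CommRing (V i)] [∀ i, Field (K i)]

/-- The ideal of the families that vanish almost everywhere. -/
def Ultrafilter.ideal : Ideal (∀ i, V i) where
  carrier := {f | ∀ᶠ i in U, f i = 0}
  add_mem' hf hg := by
    filter_upwards [hf, hg] with i h₁ h₂
    rw [Pi.add_apply, h₁, h₂, add_zero]
  zero_mem' := .of_forall fun _ ↦ rfl
  smul_mem' c f hf := by
    filter_upwards [hf] with i h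
    rw [smul_eq_mul, Pi.mul_apply, h, mul_zero]

/-- The ultraproduct of a family of rings. -/
abbrev Ultrafilter.Prod : Type _ := (∀ i, V i) ⧸ U.ideal V

variable {U V K}

lemma Ultrafilter.mk_eq_mk {f g : ∀ i, V i} :
    (Ideal.Quotient.mk (U.ideal V) f = Ideal.Quotient.mk _ g) ↔ ∀ᶠ i in U, f i = g i := by
  rw [Ideal.Quotient.eq]
  simp only [← sub_eq_zero (a := f _)]
  rfl

lemma Ultrafilter.mk_eq_zero {f : ∀ i, V i} :
    Ideal.Quotient.mk (U.ideal V) f = 0 ↔ ∀ᶠ i in U, f i = 0 :=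
  Ideal.Quotient.eq_zero_iff_mem

instance [∀ i, IsDomain (V i)] : IsDomain (U.Prod V) := by
  have : (U.ideal V).IsPrime := by
    refine ⟨fun h ↦ ?_, fun {f g} h ↦ ?_⟩
    · have h' : ∀ᶠ i in U, (1 : V i) = 0 := (Ideal.eq_top_iff_one _).mp h
      obtain ⟨i, hi⟩ := h'.exists
      exact one_ne_zero hi
    · have h' : ∀ᶠ i in U, f i = 0 ∨ g i = 0 := by
        filter_upwards [h] with i hi using mul_eq_zero.mp hi
      exact Ultrafilter.eventually_or.mp h'
  infer_instance

/-- For each index one of two elements divides the other, and an ultrafilter selects one of these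
alternatives almost everywhere. -/
instance [∀ i, IsDomain (V i)] [∀ i, ValuationRing (V i)] : ValuationRing (U.Prod V) where
  cond' a b := by
    obtain ⟨f, rfl⟩ := Ideal.Quotient.mk_surjective a
    obtain ⟨g, rfl⟩ := Ideal.Quotient.mk_surjective b
    choose c hc using fun i ↦ ValuationRing.cond (f i) (g i)
    refine ⟨Ideal.Quotient.mk _ c, ?_⟩
    rw [← map_mul, ← map_mul, Ultrafilter.mk_eq_mk, Ultrafilter.mk_eq_mk]
    exact Ultrafilter.eventually_or.mp (.of_forall hc)

instance [∀ i, IsDomain (V i)] [∀ i, ValuationRing (V i)] : IsLocalRing (U.Prod V) :=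
  ValuationRing.isLocalRing (U.Prod V)

open Classical in
instance : (U.ideal K).IsMaximal := by
  refine Ideal.Quotient.maximal_of_isField _ ⟨exists_pair_ne _, _root_.mul_comm, fun {a} ha ↦ ?_⟩
  obtain ⟨f, rfl⟩ := Ideal.Quotient.mk_surjective a
  refine ⟨Ideal.Quotient.mk _ fun i ↦ (f i)⁻¹, ?_⟩
  rw [← map_mul, ← map_one (Ideal.Quotient.mk _), Ultrafilter.mk_eq_mk]
  filter_upwards [Ultrafilter.eventually_not.mpr (Ultrafilter.mk_eq_zero.not.mp ha)] with i hi
  exact mul_inv_cancel₀ hi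

noncomputable instance : Field (U.Prod K) := Ideal.Quotient.field _

variable [∀ i, Algebra (V i) (K i)]

variable (U V K) in
/-- The map of ultraproducts induced by a family of algebras. -/
noncomputable def Ultrafilter.prodMap : U.Prod V →+* U.Prod K :=
  Ideal.quotientMap _ (RingHom.pi fun i ↦ (algebraMap (V i) (K i)).comp (Pi.evalRingHom V i))
    fun f hf ↦ by
      change ∀ᶠ i in U, algebraMap (V i) (K i) (f i) = 0
      filter_upwards [hf] with i hi
      rw [hi, map_zero]

noncomputable instance : Algebra (U.Prod V) (U.Prod K) := (U.prodMap V K).toAlgebra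

lemma Ultrafilter.algebraMap_mk (f : ∀ i, V i) :
    algebraMap (U.Prod V) (U.Prod K) (Ideal.Quotient.mk _ f) =
      Ideal.Quotient.mk _ fun i ↦ algebraMap (V i) (K i) (f i) := rfl

instance [∀ i, IsDomain (V i)] [∀ i, IsFractionRing (V i) (K i)] :
    IsFractionRing (U.Prod V) (U.Prod K) := by
  have inj : Function.Injective (algebraMap (U.Prod V) (U.Prod K)) := by
    refine (injective_iff_map_eq_zero _).mpr fun a ha ↦ ?_
    obtain ⟨f, rfl⟩ := Ideal.Quotient.mk_surjective a
    rw [Ultrafilter.algebraMap_mk, Ultrafilter.mk_eq_zero] at ha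
    rw [Ultrafilter.mk_eq_zero]
    filter_upwards [ha] with i hi
    exact (map_eq_zero_iff _ (IsFractionRing.injective (V i) (K i))).mp hi
  refine ⟨fun y ↦ ?_, fun a ↦ ?_, fun {a b} h ↦ ⟨1, by rw [inj h]⟩⟩
  · exact ((map_ne_zero_iff _ inj).mpr (nonZeroDivisors.ne_zero y.2)).isUnit
  · obtain ⟨f, rfl⟩ := Ideal.Quotient.mk_surjective a
    choose p q hq h using fun i ↦ IsFractionRing.div_surjective (A := V i) (f i)
    refine ⟨⟨Ideal.Quotient.mk _ p, Ideal.Quotient.mk _ q, mem_nonZeroDivisors_of_ne_zero ?_⟩, ?_⟩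
    · intro h0
      obtain ⟨i, hi⟩ := (Ultrafilter.mk_eq_zero.mp h0).exists
      exact nonZeroDivisors.ne_zero (hq i) hi
    · dsimp only
      rw [Ultrafilter.algebraMap_mk, Ultrafilter.algebraMap_mk, ← map_mul]
      congr 1
      ext i
      have : algebraMap (V i) (K i) (q i) ≠ 0 :=
        (map_ne_zero_iff _ (IsFractionRing.injective _ _)).mpr (nonZeroDivisors.ne_zero (hq i))
      rw [Pi.mul_apply, ← h i, div_mul_cancel₀ _ this]

end Ultraproduct

/-! ### Morphisms from spectra of products near an ultraproduct -/

section UltraproductPoints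

open Filter

variable {J : Type u} (U : Ultrafilter J) {V : J → Type u} [∀ i, CommRing (V i)]

/-- The ideal of the complement of `O` and the ideal of the ultrafilter are comaximal; `e` is the
first summand in a decomposition of `1`. -/
lemma Ultrafilter.exists_basicOpen_le (O : Set (PrimeSpectrum (∀ i, V i))) (hO : IsOpen O)
    (h : PrimeSpectrum.zeroLocus (U.ideal V : Set (∀ i, V i)) ⊆ O) :
    ∃ e : ∀ i, V i, (∀ᶠ i in U, e i = 1) ∧ (PrimeSpectrum.basicOpen e : Set _) ⊆ O := by
  obtain ⟨s, hs⟩ := (PrimeSpectrum.isClosed_iff_zeroLocus_ideal _).mp hO.isClosed_compl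
  have h₁ : s ⊔ U.ideal V = ⊤ := by
    rw [← PrimeSpectrum.zeroLocus_empty_iff_eq_top, PrimeSpectrum.zeroLocus_sup, ← hs]
    exact Set.disjoint_iff_inter_eq_empty.mp
      (Set.disjoint_left.mpr fun x hx hx' ↦ hx (h hx'))
  obtain ⟨a, ha, b, hb, hab⟩ := Submodule.mem_sup.mp ((Ideal.eq_top_iff_one _).mp h₁)
  refine ⟨a, ?_, ?_⟩
  · have hb' : ∀ᶠ i in U, b i = 0 := hb
    filter_upwards [hb'] with i hi
    have := congr_fun hab i
    rwa [Pi.add_apply, hi, add_zero] at this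
  · rw [PrimeSpectrum.basicOpen_eq_zeroLocus_compl, Set.compl_subset_comm, hs]
    exact PrimeSpectrum.zeroLocus_anti_mono (Set.singleton_subset_iff.mpr ha)

namespace AlgebraicGeometry

variable {U} {X : Scheme.{u}} {R : Type u} [CommRing R]

/-- The preimage of the affine open contains some `D(e)` with `e = 1` almost everywhere. There `L`
is a ring map into the localization at `e`, and evaluation at almost every index extends to that
localization. Clearing powers of `e` computes coordinates. -/
lemma eventually_exists_of_ultraproduct (L : Spec (.of (∀ i, V i)) ⟶ X) (w : Spec (.of R) ⟶ X)
    [IsOpenImmersion w] (l : R →+* U.Prod V)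
    (h : Spec.map (CommRingCat.ofHom (Ideal.Quotient.mk (U.ideal V))) ≫ L =
      Spec.map (CommRingCat.ofHom l) ≫ w) :
    (∀ᶠ i in U, ∃ ψ : R →+* V i, Spec.map (CommRingCat.ofHom (Pi.evalRingHom V i)) ≫ L =
      Spec.map (CommRingCat.ofHom ψ) ≫ w) ∧
    ∀ (r : R) (y : ∀ i, V i), Ideal.Quotient.mk (U.ideal V) y = l r →
      ∀ᶠ i in U, ∀ ψ : R →+* V i, Spec.map (CommRingCat.ofHom (Pi.evalRingHom V i)) ≫ L =
        Spec.map (CommRingCat.ofHom ψ) ≫ w → ψ r = y i := by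
  obtain ⟨e, he, heO⟩ := U.exists_basicOpen_le (V := V) (L ⁻¹ᵁ w.opensRange).1
    (L ⁻¹ᵁ w.opensRange).2 (by
      intro x hx
      have hx' : x ∈ Set.range (PrimeSpectrum.comap (Ideal.Quotient.mk (U.ideal V))) := by
        rw [_root_.range_comap_of_surjective _ _ Ideal.Quotient.mk_surjective,
          Ideal.mk_ker]
        exact hx
      obtain ⟨z, rfl⟩ := hx'
      exact ⟨_, congr($(h.symm) z)⟩)
  let Q := Localization.Away e
  have hQ : Set.range (Spec.map (CommRingCat.ofHom (algebraMap (∀ i, V i) Q)) ≫ L) ⊆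
      Set.range w := by
    rintro _ ⟨z, rfl⟩
    refine heO ?_
    rw [← PrimeSpectrum.localization_away_comap_range Q e]
    exact ⟨z, rfl⟩
  obtain ⟨θ, hθ⟩ := Spec.map_surjective (IsOpenImmersion.lift w _ hQ)
  have hθ' : Spec.map θ ≫ w = Spec.map (CommRingCat.ofHom (algebraMap (∀ i, V i) Q)) ≫ L := by
    rw [hθ, IsOpenImmersion.lift_fac]
  have key {S : Type u} [CommRing S] (g : (∀ i, V i) →+* S) (hg : g e = 1) :
      Spec.map (CommRingCat.ofHom g) ≫ L = Spec.map (CommRingCat.ofHom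
        ((IsLocalization.Away.lift (S := Q) e (g := g) (hg ▸ isUnit_one)).comp θ.hom)) ≫ w := by
    have h₁ : g = (IsLocalization.Away.lift (S := Q) e (g := g) (hg ▸ isUnit_one)).comp
      (algebraMap _ Q) := (IsLocalization.Away.lift_comp e _).symm
    rw [CommRingCat.ofHom_comp, Spec.map_comp_assoc, CommRingCat.ofHom_hom, hθ',
      ← Spec.map_comp_assoc, ← CommRingCat.ofHom_comp, ← h₁]
  have key' {S : Type u} [CommRing S] (g : (∀ i, V i) →+* S) (hg : g e = 1) (ψ : R →+* S)
      (hψ : Spec.map (CommRingCat.ofHom g) ≫ L = Spec.map (CommRingCat.ofHom ψ) ≫ w) (r : R)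
      (a : ∀ i, V i) (n : ℕ) (ha : θ.hom r * algebraMap _ Q (e ^ n) = algebraMap _ Q a) :
      ψ r = g a := by
    have h₂ := key g hg
    rw [hψ, cancel_mono] at h₂
    have h₃ := congr($(Spec.map_injective h₂).hom r)
    have h₄ := congr(IsLocalization.Away.lift (S := Q) e (g := g) (hg ▸ isUnit_one) $ha)
    have h₅ : g (e ^ n) = 1 := by rw [map_pow, hg, one_pow]
    rw [map_mul, IsLocalization.Away.lift_eq, IsLocalization.Away.lift_eq, h₅,
      _root_.mul_one] at h₄
    exact h₃.trans h₄
  refine ⟨?_, fun r y hy ↦ ?_⟩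
  · filter_upwards [he] with i hi
    exact ⟨_, key (Pi.evalRingHom V i) hi⟩
  · obtain ⟨n, a, ha⟩ := IsLocalization.Away.surj e (θ.hom r)
    rw [← map_pow] at ha
    have h₁ := key' _ (Ultrafilter.mk_eq_mk.mpr he) l h r a n ha
    rw [← hy, Ultrafilter.mk_eq_mk] at h₁
    filter_upwards [he, h₁] with i hi hi' ψ hψ
    rw [key' (Pi.evalRingHom V i) hi ψ hψ r a n ha, hi']
    rfl

end AlgebraicGeometry

end UltraproductPoints

/-! ### From the ultraproduct back to almost all factors -/

section UltraproductLift

open Filter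

namespace AlgebraicGeometry

/-- Every point of a local spectrum specializes to the closed point, so an open set containing the
image of that point contains the whole image. -/
lemma exists_eq_SpecMap_comp {X : Scheme.{u}} {V : Type u} [CommRing V] [IsLocalRing V]
    (L : Spec (.of V) ⟶ X) :
    ∃ (R : Type u) (_ : CommRing R) (w : Spec (.of R) ⟶ X) (_ : IsOpenImmersion w) (l : R →+* V),
      L = Spec.map (CommRingCat.ofHom l) ≫ w := by
  obtain ⟨_, ⟨W, hW, rfl⟩, hxW, -⟩ := X.isBasis_affineOpens.exists_subset_of_mem_open
    (Set.mem_univ (L (IsLocalRing.closedPoint V))) isOpen_univ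
  have h : Set.range L ⊆ Set.range hW.fromSpec := by
    rw [hW.range_fromSpec]
    rintro _ ⟨x, rfl⟩
    exact ((IsLocalRing.specializes_closedPoint x).map L.continuous).mem_open W.2 hxW
  have : IsOpenImmersion hW.fromSpec := hW.isOpenImmersion_fromSpec
  obtain ⟨l, hl⟩ := Spec.map_surjective (IsOpenImmersion.lift hW.fromSpec L h)
  refine ⟨Γ(X, W), inferInstance, hW.fromSpec, inferInstance, l.hom, ?_⟩
  rw [CommRingCat.ofHom_hom, hl, IsOpenImmersion.lift_fac]

variable {J : Type u} {U : Ultrafilter J} {V : J → Type u} [∀ i, CommRing (V i)]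
  {A : Type u} [CommRing A] {X : Scheme.{u}} (x : X ⟶ Spec (.of A)) {β : ∀ i, A →+* V i}

lemma comp_eq_of_SpecMap_eq {R S : Type u} [CommRing R] [CommRing S] {w : Spec (.of R) ⟶ X}
    {α : A →+* R} (hα : Spec.map (CommRingCat.ofHom α) = w ≫ x) {m : Spec (.of S) ⟶ X}
    {ψ : R →+* S} {δ : A →+* S} (h : m = Spec.map (CommRingCat.ofHom ψ) ≫ w)
    (h' : m ≫ x = Spec.map (CommRingCat.ofHom δ)) : ψ.comp α = δ := by
  rw [h, Category.assoc, ← hα, ← Spec.map_comp, ← CommRingCat.ofHom_comp] at h'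
  exact congr($(Spec.map_injective h').hom)

lemma SpecMap_eval_comp (i : J) {L : Spec (.of (∀ i, V i)) ⟶ X}
    (h : L ≫ x = Spec.map (CommRingCat.ofHom (RingHom.pi β))) :
    (Spec.map (CommRingCat.ofHom (Pi.evalRingHom V i)) ≫ L) ≫ x =
      Spec.map (CommRingCat.ofHom (β i)) := by
  rw [Category.assoc, h, ← Spec.map_comp, ← CommRingCat.ofHom_comp]
  rfl

/-- Two maps out of a finite type algebra are compared on finitely many generators, each giving one
condition that holds almost everywhere. -/
lemma eventually_eq_of_ultraproduct [LocallyOfFiniteType x] [IsLocalRing (U.Prod V)]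
    (L₁ L₂ : Spec (.of (∀ i, V i)) ⟶ X)
    (h₁ : L₁ ≫ x = Spec.map (CommRingCat.ofHom (RingHom.pi β)))
    (h₂ : L₂ ≫ x = Spec.map (CommRingCat.ofHom (RingHom.pi β)))
    (h : Spec.map (CommRingCat.ofHom (Ideal.Quotient.mk (U.ideal V))) ≫ L₁ =
      Spec.map (CommRingCat.ofHom (Ideal.Quotient.mk (U.ideal V))) ≫ L₂) :
    ∀ᶠ i in U, Spec.map (CommRingCat.ofHom (Pi.evalRingHom V i)) ≫ L₁ =
      Spec.map (CommRingCat.ofHom (Pi.evalRingHom V i)) ≫ L₂ := by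
  obtain ⟨R, _, w, _, l, hl⟩ := exists_eq_SpecMap_comp
    (Spec.map (CommRingCat.ofHom (Ideal.Quotient.mk (U.ideal V))) ≫ L₁)
  obtain ⟨⟨α⟩, hα⟩ := Spec.map_surjective (w ≫ x)
  change Spec.map (CommRingCat.ofHom α) = _ at hα
  let : Algebra A R := α.toAlgebra
  have : Algebra.FiniteType A R :=
    HasRingHomProperty.Spec_iff (P := @LocallyOfFiniteType) (φ := CommRingCat.ofHom α).mp
      (by rw [hα]; infer_instance)
  obtain ⟨s, hs⟩ := this.out
  obtain ⟨h₃, h₄⟩ := eventually_exists_of_ultraproduct L₁ w l hl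
  obtain ⟨h₅, h₆⟩ := eventually_exists_of_ultraproduct L₂ w l (h ▸ hl)
  choose y hy using fun r ↦ Ideal.Quotient.mk_surjective (l r)
  have h₇ := (Filter.eventually_all_finset s).mpr fun r _ ↦
    (h₄ r (y r) (hy r)).and (h₆ r (y r) (hy r))
  filter_upwards [h₃, h₅, h₇] with i ⟨ψ₁, hψ₁⟩ ⟨ψ₂, hψ₂⟩ hi
  suffices ψ₁ = ψ₂ by rw [hψ₁, hψ₂, this]
  have e₁ := comp_eq_of_SpecMap_eq x hα hψ₁ (SpecMap_eval_comp x i h₁)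
  have e₂ := comp_eq_of_SpecMap_eq x hα hψ₂ (SpecMap_eval_comp x i h₂)
  let := (β i).toAlgebra
  let Ψ₁ : R →ₐ[A] V i := { ψ₁ with commutes' := fun a ↦ congr($e₁ a) }
  let Ψ₂ : R →ₐ[A] V i := { ψ₂ with commutes' := fun a ↦ congr($e₂ a) }
  have : Ψ₁ = Ψ₂ := AlgHom.ext_of_adjoin_eq_top hs fun r hr ↦
    ((hi r hr).1 ψ₁ hψ₁).trans ((hi r hr).2 ψ₂ hψ₂).symm
  exact congr(($this : R →+* V i))

variable {K : J → Type u} [∀ i, Field (K i)] [∀ i, Algebra (V i) (K i)]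

/-- Lift the images of the generators of `R` to the product. The finitely many relations hold in the
ultraproduct, hence at almost every index, where they define a map from `R` to `V i`. -/
lemma eventually_exists_lift_of_ultraproduct [LocallyOfFinitePresentation x]
    [IsLocalRing (U.Prod V)] (I : Spec (.of (∀ i, K i)) ⟶ X) (L : Spec (.of (U.Prod V)) ⟶ X)
    (hI : I ≫ x = Spec.map (CommRingCat.ofHom
      (RingHom.pi fun i ↦ (algebraMap (V i) (K i)).comp (β i))))
    (hL : L ≫ x = Spec.map (CommRingCat.ofHom
      ((Ideal.Quotient.mk (U.ideal V)).comp (RingHom.pi β))))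
    (h : Spec.map (CommRingCat.ofHom (Ideal.Quotient.mk (U.ideal K))) ≫ I =
      Spec.map (CommRingCat.ofHom (algebraMap (U.Prod V) (U.Prod K))) ≫ L) :
    ∀ᶠ i in U, ∃ l : Spec (.of (V i)) ⟶ X, l ≫ x = Spec.map (CommRingCat.ofHom (β i)) ∧
      Spec.map (CommRingCat.ofHom (algebraMap (V i) (K i))) ≫ l =
        Spec.map (CommRingCat.ofHom (Pi.evalRingHom K i)) ≫ I := by
  obtain ⟨R, _, w, _, l, hl⟩ := exists_eq_SpecMap_comp L
  obtain ⟨⟨α⟩, hα⟩ := Spec.map_surjective (w ≫ x)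
  change Spec.map (CommRingCat.ofHom α) = _ at hα
  let : Algebra A R := α.toAlgebra
  have hαR (a : A) : algebraMap A R a = α a := rfl
  have hαl := comp_eq_of_SpecMap_eq x hα hl hL
  have : Algebra.FinitePresentation A R :=
    HasRingHomProperty.Spec_iff (P := @LocallyOfFinitePresentation) (φ := CommRingCat.ofHom α).mp
      (by rw [hα]; infer_instance)
  obtain ⟨n, f, hf, s, hs⟩ := this.out
  rw [hl, ← Spec.map_comp_assoc, ← CommRingCat.ofHom_comp] at h
  obtain ⟨h₁, h₂⟩ := eventually_exists_of_ultraproduct I w _ h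
  choose y hy using fun j ↦ Ideal.Quotient.mk_surjective (l (f (.X j)))
  have h₃ : ∀ᶠ i in U, ∀ j, ∀ ψ : R →+* K i,
      Spec.map (CommRingCat.ofHom (Pi.evalRingHom K i)) ≫ I =
        Spec.map (CommRingCat.ofHom ψ) ≫ w → ψ (f (.X j)) = algebraMap (V i) (K i) (y j i) :=
    Filter.eventually_all.mpr fun j ↦ h₂ _ (fun i ↦ algebraMap (V i) (K i) (y j i)) (by
      rw [RingHom.comp_apply, ← hy, Ultrafilter.algebraMap_mk])
  have h₄ : ∀ᶠ i in U, ∀ g ∈ s, MvPolynomial.eval₂Hom (β i) (fun j ↦ y j i) g = 0 := by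
    refine (Filter.eventually_all_finset s).mpr fun g hg ↦ ?_
    have hg' : f g = 0 := by
      have : g ∈ RingHom.ker f := hs ▸ Ideal.subset_span hg
      exact this
    have e₁ : (Ideal.Quotient.mk (U.ideal V)).comp (MvPolynomial.eval₂Hom (RingHom.pi β) y) =
        l.comp (f : MvPolynomial (Fin n) A →+* R) := by
      apply MvPolynomial.ringHom_ext
      · intro a
        have := congr($hαl a)
        simp only [RingHom.comp_apply] at this ⊢
        rw [RingHom.coe_coe, ← MvPolynomial.algebraMap_eq, AlgHom.commutes]
        simpa [hαR] using this.symm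
      · intro j
        simp [hy]
    have e₂ := congr($e₁ g)
    rw [RingHom.comp_apply, RingHom.comp_apply, RingHom.coe_coe, hg', map_zero,
      Ultrafilter.mk_eq_zero] at e₂
    filter_upwards [e₂] with i hi
    rw [← hi]
    have e₃ : MvPolynomial.eval₂Hom (β i) (fun j ↦ y j i) =
        (Pi.evalRingHom V i).comp (MvPolynomial.eval₂Hom (RingHom.pi β) y) := by
      apply MvPolynomial.ringHom_ext <;> simp
    rw [e₃]
    rfl
  filter_upwards [h₁, h₃, h₄] with i ⟨ψ, hψ⟩ hi hi'
  have hker : RingHom.ker (f : MvPolynomial (Fin n) A →+* R) ≤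
      RingHom.ker (MvPolynomial.eval₂Hom (β i) (fun j ↦ y j i)) := by
    rw [show RingHom.ker (f : MvPolynomial (Fin n) A →+* R) = Ideal.span s from hs.symm,
      Ideal.span_le]
    exact hi'
  let φ := RingHom.liftOfSurjective (f : MvPolynomial (Fin n) A →+* R) hf ⟨_, hker⟩
  have hφ : φ.comp (f : MvPolynomial (Fin n) A →+* R) =
      MvPolynomial.eval₂Hom (β i) (fun j ↦ y j i) :=
    RingHom.liftOfRightInverse_comp _ _ _ _
  have hφα : φ.comp α = β i := by
    ext a
    have := congr($hφ (.C a))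
    rw [RingHom.comp_apply, RingHom.coe_coe, ← MvPolynomial.algebraMap_eq, AlgHom.commutes] at this
    simpa [hαR] using this
  refine ⟨Spec.map (CommRingCat.ofHom φ) ≫ w, ?_, ?_⟩
  · rw [Category.assoc, ← hα, ← Spec.map_comp, ← hφα]
    rfl
  · rw [hψ, ← Spec.map_comp_assoc, ← CommRingCat.ofHom_comp]
    suffices (algebraMap (V i) (K i)).comp φ = ψ by rw [this]
    have hψα := comp_eq_of_SpecMap_eq x hα hψ (SpecMap_eval_comp x i hI)
    rw [← RingHom.cancel_right (f := (f : MvPolynomial (Fin n) A →+* R)) hf, RingHom.comp_assoc, hφ]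
    apply MvPolynomial.ringHom_ext
    · intro a
      have := congr($hψα a)
      rw [RingHom.comp_apply ψ, RingHom.coe_coe f, ← MvPolynomial.algebraMap_eq, AlgHom.commutes]
      simpa [hαR] using this.symm
    · intro j
      have := hi j ψ hψ
      simpa using this.symm

end AlgebraicGeometry

end UltraproductLift

/-! ### The valuative criterion through ultraproducts -/

section UltraproductValuative

namespace AlgebraicGeometry

variable {J : Type u} {U : Ultrafilter J} {V K : J → Type u} [∀ i, CommRing (V i)]
  {A k : Type u} [CommRing A] [CommRing k] {X : Scheme.{u}} (x : X ⟶ Spec (.of A))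
  {β : ∀ i, A →+* V i}

lemma exists_points_pi [QuasiCompact x] [∀ i, IsLocalRing (V i)] (l : ∀ i, Spec (.of (V i)) ⟶ X)
    (hl : ∀ i, l i ≫ x = Spec.map (CommRingCat.ofHom (β i))) :
    ∃ L : Spec (.of (∀ i, V i)) ⟶ X, L ≫ x = Spec.map (CommRingCat.ofHom (RingHom.pi β)) ∧
      ∀ i, Spec.map (CommRingCat.ofHom (Pi.evalRingHom V i)) ≫ L = l i := by
  have : CompactSpace X := QuasiCompact.compactSpace_of_compactSpace x
  obtain ⟨L, hL⟩ := pointsPi_surjective (fun i ↦ .of (V i)) X l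
  refine ⟨L, ?_, fun i ↦ congr_fun hL i⟩
  refine pointsPi_injective (fun i ↦ .of (V i)) _ (funext fun i ↦ ?_)
  change Spec.map (CommRingCat.ofHom (Pi.evalRingHom V i)) ≫ L ≫ x =
    Spec.map (CommRingCat.ofHom (Pi.evalRingHom V i)) ≫
      Spec.map (CommRingCat.ofHom (RingHom.pi β))
  have : Spec.map (CommRingCat.ofHom (Pi.evalRingHom V i)) ≫ L = l i := congr_fun hL i
  rw [← Category.assoc, this, hl, ← Spec.map_comp]
  rfl

section

variable {Y T : Scheme.{u}} (f : Y ⟶ T) {R F : Type u} [CommRing R] [IsDomain R] [ValuationRing R]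
  [Field F] [Algebra R F] [IsFractionRing R F]

lemma UniversallyClosed.exists_lift [UniversallyClosed f] (i₁ : Spec (.of F) ⟶ Y)
    (i₂ : Spec (.of R) ⟶ T) (w : i₁ ≫ f = Spec.map (CommRingCat.ofHom (algebraMap R F)) ≫ i₂) :
    ∃ l : Spec (.of R) ⟶ Y, Spec.map (CommRingCat.ofHom (algebraMap R F)) ≫ l = i₁ ∧
      l ≫ f = i₂ := by
  obtain ⟨⟨l, hl, hl'⟩⟩ := ((UniversallyClosed.eq_valuativeCriterion.le _ _ f ‹_›).1
    { R := R, K := F, i₁ := i₁, i₂ := i₂, commSq := ⟨w⟩ }).exists_lift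
  exact ⟨l, hl, hl'⟩

lemma IsSeparated.eq_of_valuationRing [IsSeparated f] (l₁ l₂ : Spec (.of R) ⟶ Y)
    (h : Spec.map (CommRingCat.ofHom (algebraMap R F)) ≫ l₁ =
      Spec.map (CommRingCat.ofHom (algebraMap R F)) ≫ l₂)
    (h' : l₁ ≫ f = l₂ ≫ f) : l₁ = l₂ := by
  let S : ValuativeCommSq f :=
    { R := R
      K := F
      i₁ := Spec.map (CommRingCat.ofHom (algebraMap R F)) ≫ l₁
      i₂ := l₁ ≫ f
      commSq := ⟨Category.assoc _ _ _⟩ }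
  have := IsSeparated.valuativeCriterion f S
  exact congr_arg CommSq.LiftStruct.l
    (Subsingleton.elim (⟨l₁, rfl, rfl⟩ : S.commSq.LiftStruct) ⟨l₂, h.symm, h'.symm⟩)

end

variable [∀ i, IsDomain (V i)] [∀ i, ValuationRing (V i)] [∀ i, Field (K i)]
  [∀ i, Algebra (V i) (K i)] [∀ i, IsFractionRing (V i) (K i)]
  {τ : A →+* k} {κ : k →+* U.Prod V}

/-- The points `m i` assemble to a point over the product of the fields, hence over their
ultraproduct. Together with `κ` it maps to the base change of `X` to `k`, where the valuative
criterion for the ultraproduct valuation ring supplies a lift. -/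
lemma eventually_exists_lift [LocallyOfFinitePresentation x] [QuasiCompact x]
    (hκ : κ.comp τ = (Ideal.Quotient.mk (U.ideal V)).comp (RingHom.pi β))
    [UniversallyClosed (Limits.pullback.snd x (Spec.map (CommRingCat.ofHom τ)))]
    (m : ∀ i, Spec (.of (K i)) ⟶ X)
    (hm : ∀ i, m i ≫ x = Spec.map (CommRingCat.ofHom ((algebraMap (V i) (K i)).comp (β i)))) :
    ∀ᶠ i in U, ∃ l : Spec (.of (V i)) ⟶ X, l ≫ x = Spec.map (CommRingCat.ofHom (β i)) ∧
      Spec.map (CommRingCat.ofHom (algebraMap (V i) (K i))) ≫ l = m i := by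
  obtain ⟨I, hI, hI'⟩ := exists_points_pi x m hm
  have w : (Spec.map (CommRingCat.ofHom (Ideal.Quotient.mk (U.ideal K))) ≫ I) ≫ x =
      Spec.map (CommRingCat.ofHom ((algebraMap (U.Prod V) (U.Prod K)).comp κ)) ≫
        Spec.map (CommRingCat.ofHom τ) := by
    rw [Category.assoc, hI, ← Spec.map_comp, ← Spec.map_comp, ← CommRingCat.ofHom_comp,
      ← CommRingCat.ofHom_comp, RingHom.comp_assoc, hκ]
    rfl
  obtain ⟨l, hl, hl'⟩ := UniversallyClosed.exists_lift
    (Limits.pullback.snd x (Spec.map (CommRingCat.ofHom τ))) (Limits.pullback.lift _ _ w)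
    (Spec.map (CommRingCat.ofHom κ)) (by
      rw [Limits.pullback.lift_snd, CommRingCat.ofHom_comp, Spec.map_comp])
  have h₁ := eventually_exists_lift_of_ultraproduct x I (l ≫ Limits.pullback.fst _ _) hI
    (by rw [Category.assoc, Limits.pullback.condition, ← Category.assoc, hl', ← hκ,
      CommRingCat.ofHom_comp, Spec.map_comp])
    (by rw [← Category.assoc, hl, Limits.pullback.lift_fst])
  simpa only [hI'] using h₁

lemma eventually_eq [LocallyOfFiniteType x] [QuasiCompact x] [QuasiSeparated x]
    (hκ : κ.comp τ = (Ideal.Quotient.mk (U.ideal V)).comp (RingHom.pi β))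
    [IsSeparated (Limits.pullback.snd x (Spec.map (CommRingCat.ofHom τ)))]
    (l₁ l₂ : ∀ i, Spec (.of (V i)) ⟶ X)
    (h₁ : ∀ i, l₁ i ≫ x = Spec.map (CommRingCat.ofHom (β i)))
    (h₂ : ∀ i, l₂ i ≫ x = Spec.map (CommRingCat.ofHom (β i)))
    (h : ∀ i, Spec.map (CommRingCat.ofHom (algebraMap (V i) (K i))) ≫ l₁ i =
      Spec.map (CommRingCat.ofHom (algebraMap (V i) (K i))) ≫ l₂ i) :
    ∀ᶠ i in U, l₁ i = l₂ i := by
  obtain ⟨L₁, hL₁, hL₁'⟩ := exists_points_pi x l₁ h₁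
  obtain ⟨L₂, hL₂, hL₂'⟩ := exists_points_pi x l₂ h₂
  have : QuasiSeparatedSpace X := quasiSeparatedSpace_of_quasiSeparated x
  let a : (∀ i, V i) →+* ∀ i, K i :=
    RingHom.pi fun i ↦ (algebraMap (V i) (K i)).comp (Pi.evalRingHom V i)
  have ha (i) {L : Spec (.of (∀ i, V i)) ⟶ X} :
      Spec.map (CommRingCat.ofHom (Pi.evalRingHom K i)) ≫ Spec.map (CommRingCat.ofHom a) ≫ L =
        Spec.map (CommRingCat.ofHom (algebraMap (V i) (K i))) ≫
          Spec.map (CommRingCat.ofHom (Pi.evalRingHom V i)) ≫ L := by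
    rw [← Spec.map_comp_assoc, ← Spec.map_comp_assoc]
    rfl
  have e : Spec.map (CommRingCat.ofHom a) ≫ L₁ = Spec.map (CommRingCat.ofHom a) ≫ L₂ := by
    refine pointsPi_injective (fun i ↦ .of (K i)) _ (funext fun i ↦ ?_)
    change Spec.map (CommRingCat.ofHom (Pi.evalRingHom K i)) ≫ _ =
      Spec.map (CommRingCat.ofHom (Pi.evalRingHom K i)) ≫ _
    rw [ha, ha, hL₁', hL₂', h]
  have w {L : Spec (.of (∀ i, V i)) ⟶ X}
      (hL : L ≫ x = Spec.map (CommRingCat.ofHom (RingHom.pi β))) :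
      (Spec.map (CommRingCat.ofHom (Ideal.Quotient.mk (U.ideal V))) ≫ L) ≫ x =
        Spec.map (CommRingCat.ofHom κ) ≫ Spec.map (CommRingCat.ofHom τ) := by
    rw [Category.assoc, hL, ← Spec.map_comp, ← Spec.map_comp, ← CommRingCat.ofHom_comp,
      ← CommRingCat.ofHom_comp, hκ]
  have w' {L : Spec (.of (∀ i, V i)) ⟶ X} :
      Spec.map (CommRingCat.ofHom (algebraMap (U.Prod V) (U.Prod K))) ≫
        Spec.map (CommRingCat.ofHom (Ideal.Quotient.mk (U.ideal V))) ≫ L =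
      Spec.map (CommRingCat.ofHom (Ideal.Quotient.mk (U.ideal K))) ≫
        Spec.map (CommRingCat.ofHom a) ≫ L := by
    rw [← Spec.map_comp_assoc, ← Spec.map_comp_assoc]
    rfl
  have e' := IsSeparated.eq_of_valuationRing (F := U.Prod K)
    (Limits.pullback.snd x (Spec.map (CommRingCat.ofHom τ)))
    (Limits.pullback.lift _ _ (w hL₁)) (Limits.pullback.lift _ _ (w hL₂))
    (Limits.pullback.hom_ext
      (by rw [Category.assoc, Limits.pullback.lift_fst, Category.assoc, Limits.pullback.lift_fst,
        w', w', e])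
      (by rw [Category.assoc, Limits.pullback.lift_snd, Category.assoc, Limits.pullback.lift_snd]))
    (by rw [Limits.pullback.lift_snd, Limits.pullback.lift_snd])
  have e'' := congr($e' ≫ Limits.pullback.fst _ _)
  rw [Limits.pullback.lift_fst, Limits.pullback.lift_fst] at e''
  simpa only [hL₁', hL₂'] using eventually_eq_of_ultraproduct x L₁ L₂ hL₁ hL₂ e''

end AlgebraicGeometry

end UltraproductValuative

/-! ### Spreading out properness -/

namespace FGSubring

variable {k : Type u} [Field k]

lemma exists_le_le (A B : FGSubring k) : ∃ C : FGSubring k, A ≤ C ∧ B ≤ C :=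
  ⟨⟨A.1 ⊔ B.1, A.2.sup B.2⟩, le_sup_left (a := A.1), le_sup_right (a := A.1)⟩

lemma exists_le_mem (A : FGSubring k) (x : k) : ∃ B : FGSubring k, A ≤ B ∧ x ∈ B.1 := by
  obtain ⟨C, h₁, h₂⟩ := A.exists_le_le ⟨Algebra.adjoin ℤ {x}, ⟨{x}, by simp⟩⟩
  exact ⟨C, h₁, h₂ (Algebra.subset_adjoin rfl)⟩

/-- Any ultrafilter refining `atTop` works, since each `x` lies in all sufficiently large subrings.
-/
lemma exists_ultrafilter (A : FGSubring k) :
    ∃ U : Ultrafilter (Set.Ici A), ∀ x : k, ∀ᶠ B : Set.Ici A in (U : Filter _), x ∈ B.1.1 := by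
  have : Nonempty (Set.Ici A) := ⟨A, Set.mem_Ici.mpr le_rfl⟩
  have : IsDirectedOrder (Set.Ici A) := ⟨fun B C ↦
    have ⟨D, h₁, h₂⟩ := B.1.exists_le_le C.1
    ⟨⟨D, B.2.trans h₁⟩, h₁, h₂⟩⟩
  refine ⟨.of Filter.atTop, fun x ↦ Ultrafilter.of_le _ ?_⟩
  obtain ⟨C, h₁, h₂⟩ := A.exists_le_mem x
  filter_upwards [Filter.eventually_ge_atTop (⟨C, h₁⟩ : Set.Ici A)] with B hB
  exact hB h₂

open Classical in
/-- A family of homomorphisms from all finitely generated subrings gives a homomorphism from the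
field to the ultraproduct. -/
lemma exists_ringHom {A : FGSubring k} {U : Ultrafilter (Set.Ici A)}
    (hU : ∀ x : k, ∀ᶠ B : Set.Ici A in (U : Filter _), x ∈ B.1.1) {V : Set.Ici A → Type u}
    [∀ B, CommRing (V B)] (f : ∀ B : Set.Ici A, B.1.1 →+* V B) :
    ∃ κ : k →+* U.Prod V, κ.comp A.1.val.toRingHom = (Ideal.Quotient.mk (U.ideal V)).comp
      (RingHom.pi fun B ↦ (f B).comp (Subalgebra.inclusion B.2).toRingHom) := by
  let c (x : k) (B : Set.Ici A) : V B := if h : x ∈ B.1.1 then f B ⟨x, h⟩ else 0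
  have hc (x : k) (B : Set.Ici A) (h : x ∈ B.1.1) : c x B = f B ⟨x, h⟩ := dif_pos h
  refine ⟨{
    toFun x := Ideal.Quotient.mk _ (c x)
    map_one' := ?_
    map_zero' := ?_
    map_mul' := fun x y ↦ ?_
    map_add' := fun x y ↦ ?_ }, ?_⟩
  · rw [← map_one (Ideal.Quotient.mk _), Ultrafilter.mk_eq_mk]
    exact .of_forall fun B ↦ (hc 1 B (one_mem _)).trans (map_one (f B))
  · rw [← map_mul, Ultrafilter.mk_eq_mk]
    filter_upwards [hU x, hU y] with B hx hy
    rw [Pi.mul_apply, hc x B hx, hc y B hy, hc _ B (mul_mem hx hy), ← map_mul]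
    rfl
  · rw [← map_zero (Ideal.Quotient.mk _), Ultrafilter.mk_eq_mk]
    exact .of_forall fun B ↦ (hc 0 B (zero_mem _)).trans (map_zero (f B))
  · rw [← map_add, Ultrafilter.mk_eq_mk]
    filter_upwards [hU x, hU y] with B hx hy
    rw [Pi.add_apply, hc x B hx, hc y B hy, hc _ B (add_mem hx hy), ← map_add]
    rfl
  · ext x
    change Ideal.Quotient.mk _ (c x) = _
    exact congr_arg _ (funext fun B ↦ hc x B (B.2 x.2))

variable {A : FGSubring k} {X : Scheme.{u}} (x : X ⟶ A.spec)

/-- Otherwise every subring `B ≥ A` has a valuative square with two distinct lifts; the ultraproduct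
of their valuation rings receives a map from `k`, so by separatedness over `k` the lifts agree for
some `B`. -/
lemma exists_isSeparated [LocallyOfFiniteType x] [QuasiCompact x] [QuasiSeparated x]
    [IsSeparated (Limits.pullback.snd x A.fromField)] :
    ∃ (B : FGSubring k) (hB : A ≤ B), IsSeparated (Limits.pullback.snd x (transition hB)) := by
  by_contra! H
  obtain ⟨U, hU⟩ := A.exists_ultrafilter
  have H' (B : Set.Ici A) : ∃ (S : ValuativeCommSq (Limits.pullback.snd x (transition B.2)))
      (l₁ l₂ : S.commSq.LiftStruct), l₁ ≠ l₂ := by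
    by_contra! h
    exact H B.1 B.2 (.of_valuativeCriterion _ fun S ↦ ⟨h S⟩)
  choose S l₁ l₂ hl using H'
  choose f hf using fun B ↦ Spec.map_surjective (S B).i₂
  obtain ⟨κ, hκ⟩ := exists_ringHom hU (V := fun B ↦ (S B).R) fun B ↦ (f B).hom
  have hl' (B) (l : (S B).commSq.LiftStruct) : (l.l ≫ Limits.pullback.fst _ _) ≫ x =
      Spec.map (CommRingCat.ofHom ((f B).hom.comp (Subalgebra.inclusion B.2).toRingHom)) := by
    rw [Category.assoc, Limits.pullback.condition, ← Category.assoc, l.fac_right, ← hf,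
      CommRingCat.ofHom_comp, Spec.map_comp]
    rfl
  have : IsSeparated (Limits.pullback.snd x
    (Spec.map (CommRingCat.ofHom A.1.val.toRingHom))) := ‹_›
  obtain ⟨B, hB⟩ := (eventually_eq (K := fun B ↦ (S B).K) x hκ
    (fun B ↦ (l₁ B).l ≫ Limits.pullback.fst _ _) (fun B ↦ (l₂ B).l ≫ Limits.pullback.fst _ _)
    (fun B ↦ hl' B (l₁ B)) (fun B ↦ hl' B (l₂ B)) fun B ↦ by
      rw [← Category.assoc, (l₁ B).fac_left, ← Category.assoc, (l₂ B).fac_left]).exists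
  refine hl B ?_
  ext : 1
  apply Limits.pullback.hom_ext hB
  rw [(l₁ B).fac_right, (l₂ B).fac_right]

lemma exists_universallyClosed [LocallyOfFinitePresentation x] [QuasiCompact x]
    [UniversallyClosed (Limits.pullback.snd x A.fromField)] :
    ∃ (B : FGSubring k) (hB : A ≤ B),
      UniversallyClosed (Limits.pullback.snd x (transition hB)) := by
  by_contra! H
  obtain ⟨U, hU⟩ := A.exists_ultrafilter
  have H' (B : Set.Ici A) : ∃ S : ValuativeCommSq (Limits.pullback.snd x (transition B.2)),
      ¬ S.commSq.HasLift := by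
    by_contra! h
    exact H B.1 B.2 (.of_valuativeCriterion _ h)
  choose S hS using H'
  choose f hf using fun B ↦ Spec.map_surjective (S B).i₂
  obtain ⟨κ, hκ⟩ := exists_ringHom hU (V := fun B ↦ (S B).R) fun B ↦ (f B).hom
  have hf' (B : Set.Ici A) : Spec.map (CommRingCat.ofHom ((f B).hom.comp
      (Subalgebra.inclusion B.2).toRingHom)) = (S B).i₂ ≫ transition B.2 := by
    rw [← hf, CommRingCat.ofHom_comp, Spec.map_comp]
    rfl
  have : UniversallyClosed (Limits.pullback.snd x
    (Spec.map (CommRingCat.ofHom A.1.val.toRingHom))) := ‹_›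
  obtain ⟨B, l, hl, hl'⟩ := (eventually_exists_lift (K := fun B ↦ (S B).K) x hκ
    (fun B ↦ (S B).i₁ ≫ Limits.pullback.fst _ _) fun B ↦ by
      rw [Category.assoc, Limits.pullback.condition, (S B).commSq.w_assoc, CommRingCat.ofHom_comp,
        Spec.map_comp, hf']).exists
  refine hS B ⟨⟨⟨Limits.pullback.lift l (S B).i₂ (hl.trans (hf' B)), ?_,
    Limits.pullback.lift_snd _ _ _⟩⟩⟩
  apply Limits.pullback.hom_ext
  · rw [Category.assoc, Limits.pullback.lift_fst, hl']
  · rw [Category.assoc, Limits.pullback.lift_snd, (S B).commSq.w]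

lemma isPullback_transition {B C : FGSubring k} (hB : A ≤ B) (hC : B ≤ C) :
    ∃ p, IsPullback p (Limits.pullback.snd x (transition (hB.trans hC)))
      (Limits.pullback.snd x (transition hB)) (transition hC) := by
  have e : transition hC ≫ transition hB = transition (hB.trans hC) := by
    rw [transition, transition, ← Spec.map_comp]
    rfl
  have h := IsPullback.of_hasPullback x (transition (hB.trans hC))
  refine ⟨Limits.pullback.lift (Limits.pullback.fst _ _) (Limits.pullback.snd _ _ ≫ transition hC)
    (by rw [Category.assoc, e, h.w]), IsPullback.of_right ?_ (Limits.pullback.lift_snd _ _ _)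
    (IsPullback.of_hasPullback x (transition hB))⟩
  rw [Limits.pullback.lift_fst, e]
  exact h

/-- Properness spreads out from a field to its finitely generated subrings. -/
theorem exists_isProper (hx : IsOfFinitePresentation x)
    (h : IsProper (Limits.pullback.snd x A.fromField)) :
    ∃ (B : FGSubring k) (hB : A ≤ B), IsProper (Limits.pullback.snd x (transition hB)) := by
  obtain ⟨_, _, _⟩ := hx
  obtain ⟨B, hB, _⟩ := exists_isSeparated x
  obtain ⟨C, hC, _⟩ := exists_universallyClosed x
  obtain ⟨E, hE, hE'⟩ := exists_le_le B C
  obtain ⟨p, hp⟩ := isPullback_transition x hB hE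
  obtain ⟨q, hq⟩ := isPullback_transition x hC hE'
  have : IsSeparated (Limits.pullback.snd x (transition (hB.trans hE))) :=
    MorphismProperty.of_isPullback hp ‹_›
  have : UniversallyClosed (Limits.pullback.snd x (transition (hB.trans hE))) :=
    MorphismProperty.of_isPullback hq ‹_›
  exact ⟨E, hB.trans hE, { }⟩

end FGSubring

/-! ### Units in large subrings and assembly of the realization -/

namespace FGSubring

variable {k : Type u} [Field k]

instance (A : FGSubring k) : IsNoetherianRing A.1 :=
  have : Algebra.FiniteType ℤ A.1 := A.1.fg_iff_finiteType.mp A.2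
  Algebra.FiniteType.isNoetherianRing ℤ A.1

lemma isUnit_of_inv_mem {A : FGSubring k} {a : A.1} (ha : a ≠ 0) (h : (a : k)⁻¹ ∈ A.1) :
    IsUnit a :=
  .of_mul_eq_one ⟨_, h⟩ (Subtype.ext (mul_inv_cancel₀ (by simpa using ha)))

lemma exists_le_isUnit (A : FGSubring k) {a : A.1} (ha : a ≠ 0) :
    ∃ B : FGSubring k, A ≤ B ∧ ∀ (C : FGSubring k) (h : A ≤ C), B ≤ C →
      IsUnit (Subalgebra.inclusion h a) := by
  refine ⟨⟨A.1 ⊔ Algebra.adjoin ℤ {(a : k)⁻¹}, A.2.sup (⟨{(a : k)⁻¹}, by simp⟩)⟩,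
    le_sup_left (a := A.1), fun C h h' ↦ isUnit_of_inv_mem ?_ ?_⟩
  · exact fun h₀ ↦ ha (Subalgebra.inclusion_injective h (by rw [h₀, map_zero]))
  · exact h' (le_sup_right (a := A.1) (Algebra.subset_adjoin rfl))

end FGSubring

namespace ActionData

variable {k : Type u} [Field k] {n : ℕ} {D : ActionData (Spec (.of k)) n}

variable (R : D.Realization)

/-- The members of a realization are cartesian over each other. -/
noncomputable def Realization.cart {A B : Set.Ici R.base} (h : A ≤ B) :
    Cart (R.obj B) (R.obj A) (FGSubring.transition h) :=
  ((Cart.ofIso (R.iso h)).comp (Cart.ofBaseChange _ _)).congr (Category.id_comp _)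

/-- The realized data are cartesian over the members of a realization. -/
noncomputable def Realization.cartField (A : Set.Ici R.base) :
    Cart D (R.obj A) A.1.fromField :=
  ((Cart.ofIso (R.isoField A)).comp (Cart.ofBaseChange _ _)).congr (Category.id_comp _)

lemma Realization.X_comp_cart {A B : Set.Ici R.base} (h : A ≤ B) :
    (R.iso h).X.hom.left ≫ (R.cart h).X = Limits.pullback.fst _ _ := by
  rw [cart, Cart.congr_X]
  change (R.iso h).X.hom.left ≫ (R.iso h).X.inv.left ≫ _ = _
  rw [← Over.comp_left_assoc, Iso.hom_inv_id, Over.id_left, Category.id_comp]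
  rfl

lemma Realization.X_comp_cartField (A : Set.Ici R.base) :
    (R.isoField A).X.hom.left ≫ (R.cartField A).X = Limits.pullback.fst _ _ := by
  rw [cartField, Cart.congr_X]
  change (R.isoField A).X.hom.left ≫ (R.isoField A).X.inv.left ≫ _ = _
  rw [← Over.comp_left_assoc, Iso.hom_inv_id, Over.id_left, Category.id_comp]
  rfl

/-- Finitely generated rings are noetherian, so finite type suffices. -/
lemma isOfFinitePresentation_orbitClosure {A : FGSubring k} (E : ActionData A.spec n)
    (h : IsOfFinitePresentation E.X.hom) : IsOfFinitePresentation E.orbitClosure.hom := by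
  obtain ⟨_, _, _⟩ := h
  change IsOfFinitePresentation (E.orbitIdeal.subschemeι ≫ E.X.hom)
  exact ⟨LocallyOfFinitePresentation.iff_locallyOfFiniteType.mpr inferInstance,
    inferInstance, inferInstance⟩

/-- If the formation of the orbit closures commutes with base change, then they realize the orbit
closure over the field. -/
noncomputable def Realization.orbitClosure (base : FGSubring k) (hb : R.base ≤ base)
    (h : ∀ A : Set.Ici base, (R.obj ⟨A, hb.trans A.2⟩).OrbitClosureCommutes) :
    R.ClosedSubscheme D.orbitClosureι where
  base := base
  le_base := hb
  obj A := (R.obj ⟨A, hb.trans A.2⟩).orbitClosure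
  incl A := (R.obj ⟨A, hb.trans A.2⟩).orbitClosureι
  closed _ := inferInstanceAs (IsClosedImmersion (R.obj _).orbitIdeal.subschemeι)
  finPres _ := isOfFinitePresentation_orbitClosure _ (R.finPres_X _)
  isoField A := ((h A).exists_iso (R.cartField ⟨A, hb.trans A.2⟩) (R.isoField _).X.hom
    (R.X_comp_cartField _)).choose
  isoField_comp A := ((h A).exists_iso (R.cartField ⟨A, hb.trans A.2⟩) (R.isoField _).X.hom
    (R.X_comp_cartField _)).choose_spec
  iso {A B} hAB := ((h A).exists_iso
    (R.cart (A := ⟨A, hb.trans A.2⟩) (B := ⟨B, hb.trans B.2⟩) hAB)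
    (R.iso (A := ⟨A, hb.trans A.2⟩) (B := ⟨B, hb.trans B.2⟩) hAB).X.hom
    (R.X_comp_cart _)).choose
  iso_comp {A B} hAB := ((h A).exists_iso
    (R.cart (A := ⟨A, hb.trans A.2⟩) (B := ⟨B, hb.trans B.2⟩) hAB)
    (R.iso (A := ⟨A, hb.trans A.2⟩) (B := ⟨B, hb.trans B.2⟩) hAB).X.hom
    (R.X_comp_cart _)).choose_spec

lemma Realization.exists_isProper (hX : IsProper D.X.hom) :
    ∃ B : FGSubring k, ∀ A : Set.Ici R.base, B ≤ A → IsProper (R.obj A).X.hom := by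
  let A₀ : Set.Ici R.base := ⟨R.base, Set.mem_Ici.mpr le_rfl⟩
  have h : IsProper (Limits.pullback.snd (R.obj A₀).X.hom A₀.1.fromField) := by
    rw [← (R.cartField A₀).isPullback_X.isoPullback_inv_snd]
    infer_instance
  obtain ⟨B, hB, h'⟩ := FGSubring.exists_isProper (A := A₀.1) (R.obj A₀).X.hom (R.finPres_X A₀) h
  refine ⟨B, fun A hA ↦ ?_⟩
  let B' : Set.Ici R.base := ⟨B, hB⟩
  have : IsProper (R.obj B').X.hom := by
    rw [← (R.cart (A := A₀) (B := B') hB).isPullback_X.isoPullback_hom_snd]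
    have : IsProper (Limits.pullback.snd (R.obj A₀).X.hom
      (FGSubring.transition (A := A₀.1) (B := B'.1) hB)) := h'
    infer_instance
  exact MorphismProperty.of_isPullback (R.cart (A := B') (B := A) hA).isPullback_X this

lemma Realization.exists_orbitClosureCommutes
    (hR : ∃ A₁ : FGSubring k, ∀ A : Set.Ici R.base, A₁ ≤ A →
      GeometricallyIntegral (R.obj A).Z.hom ∧ ∀ i, GeometricallyIntegral ((R.obj A).H i).hom) :
    ∃ B : FGSubring k, ∀ A : Set.Ici R.base, B ≤ A →
      (R.obj A).OrbitClosureCommutes ∧ Flat (R.obj A).orbitClosure.hom := by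
  obtain ⟨A₁, hA₁⟩ := hR
  obtain ⟨A₀, h₀, h₁⟩ := FGSubring.exists_le_le R.base A₁
  obtain ⟨hZ, hH⟩ := hA₁ ⟨A₀, h₀⟩ h₁
  obtain ⟨_, _, _⟩ := R.finPres_Z ⟨A₀, h₀⟩
  have hH' (i) := R.finPres_H ⟨A₀, h₀⟩ i
  obtain ⟨a, ha, H⟩ := ActionData.exists_orbitClosureCommutes (R.obj ⟨A₀, h₀⟩) (R.finPres_X _)
    ⟨hZ, inferInstance, inferInstance⟩ fun i ↦
      have := (hH' i).1
      ⟨hH i, inferInstance, (hH' i).2.1⟩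
  obtain ⟨B, hB, h⟩ := A₀.exists_le_isUnit ha
  refine ⟨B, fun A hA ↦ ?_⟩
  -- `B` contains the inverse of `a`, so `a` is a unit in every larger `A`.
  exact H _ _ (R.obj A) (R.cart (A := ⟨A₀, h₀⟩) (B := A) (hB.trans hA)) (h A (hB.trans hA) hA)

end ActionData

theorem corollary4p5 {k : Type u} [Field k] {n : ℕ} (D : ActionData (Spec (.of k)) n)
    (hX : IsProper D.X.hom) (R : D.Realization)
    (hR : ∃ A₁ : FGSubring k, ∀ A : Set.Ici R.base, A₁ ≤ A →
      GeometricallyIntegral (R.obj A).Z.hom ∧ ∀ i, GeometricallyIntegral ((R.obj A).H i).hom) :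
    ∃ (Y : R.ClosedSubscheme D.orbitClosureι) (A₂ : FGSubring k),
      ∀ A : Set.Ici Y.base, A₂ ≤ A →
        IsProper (Y.obj A).hom ∧ Flat (Y.obj A).hom ∧ GeometricallyIntegral (Y.obj A).hom ∧
        ∀ (K : Type u) [Field K] [IsAlgClosed K] (s : Spec (.of K) ⟶ A.1.spec),
          Nonempty (Over.mk ((Over.pullback s).map (Y.incl A)) ≅
            Over.mk ((R.obj ⟨A, Y.le_base.trans A.2⟩).baseChange s).orbitClosureι) := by
  obtain ⟨B, hB⟩ := R.exists_isProper hX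
  obtain ⟨C, hC⟩ := R.exists_orbitClosureCommutes hR
  obtain ⟨base, hb, hb'⟩ := FGSubring.exists_le_le R.base C
  have h (A : Set.Ici base) := hC ⟨A, hb.trans A.2⟩ (hb'.trans A.2)
  refine ⟨R.orbitClosure base hb fun A ↦ (h A).1, B, fun A hA ↦ ⟨?_, (h A).2,
    (h A).1.geometricallyIntegral, fun K _ _ s ↦ ?_⟩⟩
  · have := hB ⟨A, hb.trans A.2⟩ hA
    exact inferInstanceAs (IsProper ((R.obj _).orbitIdeal.subschemeι ≫ (R.obj _).X.hom))
  -- The base change along `s` is itself cartesian over the member at `A`, with the pulled-back `X`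
  -- as its ambient scheme; hence the identity as comparison map.
  · obtain ⟨e, he⟩ := (h A).1.exists_iso
      (ActionData.Cart.ofBaseChange (R.obj ⟨A, hb.trans A.2⟩) s) (𝟙 _) (Category.id_comp _)
    exact ⟨Over.isoMk e (he.trans (Category.comp_id _))⟩
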